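/- For $n\ge 0$ and $j=0,\dots,2n$ let $$C_{j,n}(u)=\frac{2^{2n}}{2\pi\binom{2n}{n}}\Big(\frac{1+\cos\big(u-\frac{2\pi j}{2n+1}\big)}{2}\Big)^n,\qquad u\in\mathbb R,$$ and for $c=(c_0,\dots,c_{2n})$ with $c_j\ge 0$ and $\sum_{j} c_j=1$ let $C_n=\sum_{j=0}^{2n}c_jC_{j,n}$. For a finite real sequence let $v$ be the number of its sign changes, from positive to negative or vice versa (zero terms are skipped). For $x=(x_1,\dots,x_m)$ the cyclic variation is $\mathring v(x)=v(x_i,x_{i+1},\dots,x_m,x_1,\dots,x_{i-1},x_i)$ for any $i$ with $x_i\ne0$ (the value does not depend on $i$), and $\mathring v(x)=0$ if $x=0$. For a function $f$ on $\mathbb S^1=\mathbb R/2\pi\mathbb Z$ let $$\mathring v(f)=\sup\{\mathring v(f(x_1),\dots,f(x_m)) : m\ge2,\ 0\le x_1<\dots<x_m<2\pi\},\qquad Z(f)=\#\{x\in[0,2\pi):f(x)=0\}$$ (both possibly $+\infty$). A sequence $x$ is called periodically unimodal if $\mathring v(x_2-x_1,\dots,x_m-x_{m-1},x_1-x_m)=2$,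 and a differentiable function $f$ on $\mathbb S^1$ is called periodically unimodal if $\mathring v(f')=2$. **Theorem.** With $c$ and $C_n$ as above: (i) For every $\alpha\ge0$, $$\mathring v(C_n-\alpha)\le Z(C_n-\alpha)\qquad\text{and}\qquad \mathring v(C_n-\alpha)\le \mathring v\Big(\frac{2n+1}{2\pi}c-\alpha\Big),$$ where $\frac{2n+1}{2\pi}c-\alpha$ is the sequence $\big(\frac{2n+1}{2\pi}c_j-\alpha\big)_{j=0}^{2n}$. If moreover at least two of the terms of this sequence are nonzero (for $n=0$: if its only term is nonzero), then $$\mathring v(C_n-\alpha)\le Z(C_n-\alpha)\le \mathring v\Big(\frac{2n+1}{2\pi}c-\alpha\Big).$$ (ii) With $c_{2n+1}=c_0$, $$\operatorname{TV}(C_n):=\int_0^{2\pi}|C_n'(u)|\,du\le\frac{2n+1}{2\pi}\sum_{j=0}^{2n}|c_{j+1}-c_j|\le\frac{2n+1}{\pi}.$$ (iii) If $c$ is periodically unimodal, then $C_n$ is periodically unimodal. -/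

import Mathlib

namespace VPMixture

noncomputable section

/-- Number of pairs of consecutive terms of opposite strict sign. -/
def adjacentChanges : List ℝ → ℕ
  | a :: b :: l => (if a * b < 0 then 1 else 0) + adjacentChanges (b :: l)
  | _ => 0

/-- `v(x)`: the number of sign changes (positive to negative or vice versa) in the terms of a finite
sequence; vanishing terms are skipped. -/
def variation (l : List ℝ) : ℕ :=
  adjacentChanges (l.filter fun a => decide (a ≠ 0))

/-- The sequence `(x_i, x_{i+1}, …, x_m, x_1, …, x_{i-1}, x_i)`. -/
def cycleFrom {m : ℕ} (x : Fin m → ℝ) (i : Fin m) : List ℝ :=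
  (List.ofFn x).rotate i ++ [x i]

/-- The cyclic variation of a finite sequence: the common value of `variation (cycleFrom x i)` over
all `i` with `x i ≠ 0` (see `cyclicVariation_eq`), and `0` if `x = 0`. -/
def cyclicVariation {m : ℕ} (x : Fin m → ℝ) : ℕ :=
  (Finset.univ.filter fun i => x i ≠ 0).sup fun i => variation (cycleFrom x i)

/-- The cyclic difference `(x_2 - x_1, …, x_m - x_{m-1}, x_1 - x_m)`; the addition of `Fin m` is
cyclic. -/
def cyclicDiff {m : ℕ} [NeZero m] (x : Fin m → ℝ) : Fin m → ℝ :=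
  fun i => x (i + 1) - x i

/-- A finite sequence is periodically unimodal if its cyclic difference has cyclic variation `2`. -/
def PeriodicallyUnimodalSeq {m : ℕ} [NeZero m] (x : Fin m → ℝ) : Prop :=
  cyclicVariation (cyclicDiff x) = 2

/-- The cyclic variation of a function on the circle `ℝ / 2πℤ`, represented by `[0, 2π)`. -/
def cyclicVariationFun (f : ℝ → ℝ) : ℕ∞ :=
  ⨆ (m : ℕ) (_ : 2 ≤ m) (x : Fin m → ℝ) (_ : StrictMono x)
    (_ : ∀ i, x i ∈ Set.Ico (0 : ℝ) (2 * Real.pi)), (cyclicVariation (fun i => f (x i)) : ℕ∞)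

/-- The number of zeros in `[0, 2π)`. -/
def zeroCount (f : ℝ → ℝ) : ℕ∞ :=
  {x : ℝ | x ∈ Set.Ico (0 : ℝ) (2 * Real.pi) ∧ f x = 0}.encard

/-- A differentiable function on the circle, i.e. a differentiable `2π`-periodic function on `ℝ`, is
periodically unimodal if its derivative has cyclic variation `2`. -/
def PeriodicallyUnimodal (f : ℝ → ℝ) : Prop :=
  Function.Periodic f (2 * Real.pi) ∧ Differentiable ℝ f ∧ cyclicVariationFun (deriv f) = 2

/-- The De la Vallée Poussin basis density `C_{j,n}`. -/
def basisDensity (n : ℕ) (j : Fin (2 * n + 1)) (u : ℝ) : ℝ :=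
  2 ^ (2 * n) / (2 * Real.pi * ((2 * n).choose n : ℝ)) *
    ((1 + Real.cos (u - 2 * Real.pi * (j : ℝ) / (2 * (n : ℝ) + 1))) / 2) ^ n

/-- The mixture `C_n = ∑ c_j C_{j,n}`. -/
def mixture (n : ℕ) (c : Fin (2 * n + 1) → ℝ) (u : ℝ) : ℝ :=
  ∑ j, c j * basisDensity n j u

/-- The rescaled coefficient vector `((2n+1)/2π) c`. -/
def scaledCoeff (n : ℕ) (c : Fin (2 * n + 1) → ℝ) (j : Fin (2 * n + 1)) : ℝ :=
  (2 * (n : ℝ) + 1) / (2 * Real.pi) * c j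

/-- The total variation over one period of a continuously differentiable function on the circle. -/
def totalVariation (f : ℝ → ℝ) : ℝ :=
  ∫ u in (0 : ℝ)..(2 * Real.pi), |deriv f u|

/-- Mixtures are smooth, so `totalVariation` is an honest integral for them. -/
theorem contDiff_mixture (n : ℕ) (c : Fin (2 * n + 1) → ℝ) :
    ContDiff ℝ (⊤ : ℕ∞) (mixture n c) := by
  unfold mixture basisDensity
  fun_prop

theorem adjacentChanges_split (a : ℝ) (q : List ℝ) : ∀ p : List ℝ,
    adjacentChanges (p ++ a :: q) = adjacentChanges (p ++ [a]) + adjacentChanges (a :: q)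
  | [] => by simp [adjacentChanges]
  | [b] => by simp [adjacentChanges]
  | b :: b' :: p => by
      have h := adjacentChanges_split a q (b' :: p)
      simp only [List.cons_append, adjacentChanges] at h ⊢
      rw [h, add_assoc]

theorem variation_split {a : ℝ} (ha : a ≠ 0) (p q : List ℝ) :
    variation (p ++ a :: q) = variation (p ++ [a]) + variation (a :: q) := by
  simp only [variation, List.filter_append, List.filter_cons, ha, ne_eq, not_false_eq_true,
    decide_true, if_true, List.filter_nil]
  exact adjacentChanges_split _ _ _

theorem variation_cycleFrom_eq {m : ℕ} (x : Fin m → ℝ) {i j : Fin m} (hi : x i ≠ 0)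
    (hj : x j ≠ 0) : variation (cycleFrom x i) = variation (cycleFrom x j) := by
  wlog hij : i < j generalizing i j
  · rcases eq_or_lt_of_le (not_lt.mp hij) with h | h
    · rw [h]
    · exact (this hj hi h).symm
  have hlen : (List.ofFn x).length = m := by simp
  obtain ⟨A, B, D, hABD, hA, hB⟩ : ∃ A B D : List ℝ,
      List.ofFn x = A ++ x i :: B ++ x j :: D ∧ A.length = i ∧
        (A ++ x i :: B).length = j := by
    have h1 : List.ofFn x = (List.ofFn x).take j ++ x j :: (List.ofFn x).drop (j + 1) := by
      conv_lhs => rw [← List.take_append_drop (j : ℕ) (List.ofFn x)]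
      rw [List.drop_eq_getElem_cons (by simp)]
      simp
    have h2 : (List.ofFn x).take j = (List.ofFn x).take i ++ x i ::
        ((List.ofFn x).take j).drop (i + 1) := by
      have hlt : (i : ℕ) < j := hij
      conv_lhs => rw [← List.take_append_drop (i : ℕ) ((List.ofFn x).take j)]
      rw [List.drop_eq_getElem_cons (by simp; omega), List.take_take]
      simp [min_eq_left hlt.le]
    refine ⟨(List.ofFn x).take i, ((List.ofFn x).take j).drop (i + 1),
      (List.ofFn x).drop (j + 1), ?_, by simp, ?_⟩
    · rw [← h2]; exact h1
    · rw [← h2]; simp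
  have ri : cycleFrom x i = (x i :: B) ++ x j :: (D ++ A ++ [x i]) := by
    unfold cycleFrom
    rw [hABD, ← hA, List.append_assoc, List.rotate_append_length_eq]
    simp
  have rj : cycleFrom x j = (x j :: (D ++ A)) ++ x i :: (B ++ [x j]) := by
    unfold cycleFrom
    rw [hABD, ← hB, List.rotate_append_length_eq]
    simp
  rw [ri, rj, variation_split hj, variation_split hi, add_comm]
  simp

/-- The cyclic variation does not depend on the index at which the cycle is started. -/
theorem cyclicVariation_eq {m : ℕ} (x : Fin m → ℝ) {i : Fin m} (hi : x i ≠ 0) :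
    cyclicVariation x = variation (cycleFrom x i) := by
  apply le_antisymm
  · refine Finset.sup_le fun j hj => ?_
    exact (variation_cycleFrom_eq x (Finset.mem_filter.mp hj).2 hi).le
  · exact Finset.le_sup (f := fun i => variation (cycleFrom x i))
      (Finset.mem_filter.mpr ⟨Finset.mem_univ i, hi⟩)

end

end VPMixture

/-!
# Variation diminution of De la Vallée Poussin mixtures

The densities `C_{j,n}` sum to the constant `(2n+1)/2π`, because summing
`e^{-inu} (1 + e^{iu})^{2n}` over the rotations of `u` by multiples of `2π/(2n+1)` leaves only its
constant term (`sum_basisDensity`). Hence `C_n - α` is, up to a positive factor, `∑ a_j C_{j,n}`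
with `a_j = (2n+1)/(2π) c_j - α`, and also `∑ a_j sin((u - θ_j)/2)^(2n)` with equidistant angles
`θ_j` (`mixture_sub_eq_sinPowerSum`).

The zeros of such a sum of powers are counted by a cyclic form of Sylvester's theorem. Cutting the
circle at `ξ`, dividing by `sin((u - ξ)/2)^m` and differentiating replaces the exponent `m` by
`m - 1` and `a_j` by `a_j sin((θ_j - ξ)/2)`, and by Rolle's theorem it loses at most one zero
(`zeroCount_sinPowerSum_succ_le`). Placing one cut at each of the cyclic sign changes of `a`, an
even number that is at most `2n`, leaves coefficients of one sign and an even exponent. If two of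
these coefficients are nonzero (one, for `n = 0`), the final sum has no zero, so the original one
has at most as many zeros as `a` has cyclic sign changes (`zeroCount_sinPowerSum_zeroAngle_le`). By
the intermediate value theorem the zeros bound the sign changes of `C_n - α`
(`cyclicVariationFun_le_zeroCount`), and with fewer than two nonzero coefficients `C_n - α` does
not change sign.

The bound on the total variation follows by integrating over the level: for a cyclic sequence,
`∫ v̊(x - α) dα = ∑ |x_{i+1} - x_i|` (`lintegral_cyclicVariation_sub`), which is applied to `c` and
to the values of `C_n` on fine equidistant grids.

For unimodality, four alternating slopes of `C_n` would give two peaks above and two valleys below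
a common level `α` (`exists_alternating_level`), hence at least four sign changes of `C_n - α`,
while the coefficients minus `α` have at most two (`cyclicVariation_sub_le_two`). A nonconstant
periodic function has both positive and negative slopes, and `C_n` is constant only if `c` is.
-/

namespace VPMixture

/-! ### Sign changes of finite sequences -/

theorem adjacentChanges_cons_le_of_sublist {l l' : List ℝ} (h : l'.Sublist l) :
    (∀ x ∈ l, x ≠ 0) → ∀ a : ℝ, a ≠ 0 → adjacentChanges (a :: l') ≤ adjacentChanges (a :: l) := by
  induction h with
  | slnil => exact fun _ _ _ => le_rfl
  | @cons l₁ l₂ b h ih =>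
    intro hl a ha
    have hb : b ≠ 0 := hl b (by simp)
    refine (ih (fun x hx => hl x (by simp [hx])) a ha).trans ?_
    cases l₂ with
    | nil => simp [adjacentChanges]
    | cons d l₂ =>
      have hd : d ≠ 0 := hl d (by simp)
      have : a * d < 0 → a * b < 0 ∨ b * d < 0 := by
        rcases lt_or_gt_of_ne ha with ha | ha <;> rcases lt_or_gt_of_ne hb with hb | hb <;>
          rcases lt_or_gt_of_ne hd with hd | hd <;> intro had <;>
          first
          | exact Or.inl (by nlinarith)
          | exact Or.inr (by nlinarith)
      simp only [adjacentChanges]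
      split_ifs <;> first | omega | tauto
  | @cons_cons l₁ l₂ b h ih =>
    intro hl a ha
    simp only [adjacentChanges]
    exact Nat.add_le_add_left (ih (fun x hx => hl x (by simp [hx])) b (hl b (by simp))) _

theorem adjacentChanges_le_of_sublist {l l' : List ℝ} (h : l'.Sublist l)
    (hl : ∀ x ∈ l, x ≠ 0) : adjacentChanges l' ≤ adjacentChanges l := by
  induction h with
  | slnil => exact le_rfl
  | @cons l₁ l₂ b h ih =>
    refine (ih fun x hx => hl x (by simp [hx])).trans ?_
    cases l₂ <;> simp [adjacentChanges]
  | @cons_cons l₁ l₂ b h ih =>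
    exact adjacentChanges_cons_le_of_sublist h (fun x hx => hl x (by simp [hx])) b (hl b (by simp))

theorem variation_le_of_sublist {l l' : List ℝ} (h : l'.Sublist l) :
    variation l' ≤ variation l :=
  adjacentChanges_le_of_sublist (h.filter _) fun x hx => by simpa using (List.mem_filter.mp hx).2

/-- The number of sign changes between two nonzero terms is even exactly if they have the same
sign. -/
theorem neg_one_pow_adjacentChanges (b : ℝ) (hb : b ≠ 0) (q : List ℝ) :
    (∀ x ∈ q, x ≠ 0) → ∀ a : ℝ, a ≠ 0 →
      0 < (-1 : ℝ) ^ adjacentChanges (a :: (q ++ [b])) * (a * b) := by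
  induction q with
  | nil =>
    intro _ a ha
    rcases lt_or_gt_of_ne (mul_ne_zero ha hb) with h | h
    · simp [adjacentChanges, h]
    · simp [adjacentChanges, h, not_lt.mpr h.le]
  | cons d q ih =>
    intro hq a ha
    have hd : d ≠ 0 := hq d (by simp)
    have := ih (fun x hx => hq x (by simp [hx])) d hd
    simp only [List.cons_append, adjacentChanges, pow_add]
    rcases lt_or_gt_of_ne (mul_ne_zero ha hd) with h | h
    · simp only [h, if_true, pow_one]
      have h2 : 0 < d * d := mul_self_pos.mpr hd
      nlinarith [mul_pos this (neg_pos.mpr h)]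
    · simp only [not_lt.mpr h.le, if_false, pow_zero, one_mul]
      have h2 : 0 < d * d := mul_self_pos.mpr hd
      nlinarith [mul_pos this h]

/-- An alternating subsequence as long as the number of sign changes permits. -/
theorem exists_isChain_sublist (q : List ℝ) : (∀ x ∈ q, x ≠ 0) → ∀ a : ℝ, a ≠ 0 →
    ∃ l : List ℝ, l.Sublist q ∧ (a :: l).IsChain (fun x y => x * y < 0) ∧
      l.length = adjacentChanges (a :: q) := by
  induction q with
  | nil => exact fun _ a _ => ⟨[], by simp, by simp, by simp [adjacentChanges]⟩
  | cons b q ih =>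
    intro hq a ha
    have hb : b ≠ 0 := hq b (by simp)
    obtain ⟨l, hl, hc, hlen⟩ := ih (fun x hx => hq x (by simp [hx])) b hb
    rcases lt_or_gt_of_ne (mul_ne_zero ha hb) with h | h
    · exact ⟨b :: l, hl.cons_cons b, hc.cons_cons h, by
        simp [adjacentChanges, h, hlen]; omega⟩
    · refine ⟨l, hl.cons b, ?_, by simp [adjacentChanges, not_lt.mpr h.le, hlen]⟩
      cases l with
      | nil => simp
      | cons d l =>
        rw [List.isChain_cons_cons] at hc ⊢
        refine ⟨?_, hc.2⟩
        have h2 : 0 < b * b := mul_self_pos.mpr hb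
        nlinarith [mul_pos h (neg_pos.mpr hc.1)]

theorem adjacentChanges_of_isChain (l : List ℝ) : ∀ a : ℝ,
    (a :: l).IsChain (fun x y => x * y < 0) → adjacentChanges (a :: l) = l.length := by
  induction l with
  | nil => exact fun a _ => by simp [adjacentChanges]
  | cons b l ih =>
    intro a h
    rw [List.isChain_cons_cons] at h
    simp only [adjacentChanges, h.1, if_true, ih b h.2, List.length_cons]
    omega

theorem isChain_sign (l : List ℝ) : ∀ a : ℝ, a ≠ 0 →
    (a :: l).IsChain (fun x y => x * y < 0) →
      ∀ i (hi : i < (a :: l).length), 0 < a * (-1) ^ i * (a :: l)[i] := by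
  induction l with
  | nil =>
    intro a ha _ i hi
    have : i = 0 := by simpa using hi
    subst this
    simpa using mul_self_pos.mpr ha
  | cons b l ih =>
    intro a ha h i hi
    rw [List.isChain_cons_cons] at h
    cases i with
    | zero => simpa using mul_self_pos.mpr ha
    | succ i =>
      have hb : b ≠ 0 := by rintro rfl; simp at h
      have hi' : i < (b :: l).length := by simpa using hi
      have := ih b hb h.2 i hi'
      simp only [List.getElem_cons_succ, pow_succ]
      have h2 : 0 < b * b := mul_self_pos.mpr hb
      have h3 := mul_pos this (neg_pos.mpr h.1)
      have h4 : b * (-1) ^ i * (b :: l)[i] * -(a * b)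
          = b * b * (a * ((-1) ^ i * -1) * (b :: l)[i]) := by ring
      rw [h4] at h3
      exact (pos_iff_pos_of_mul_pos h3).mp h2

/-! ### Cyclic variation and alternating subsequences -/

theorem exists_filter_cycleFrom {m : ℕ} (x : Fin m → ℝ) (hx : x ≠ 0) :
    ∃ (i : Fin m) (q : List ℝ), x i ≠ 0 ∧
      (List.ofFn x).filter (fun a => decide (a ≠ 0)) = x i :: q ∧
      (cycleFrom x i).filter (fun a => decide (a ≠ 0)) = x i :: (q ++ [x i]) := by
  obtain ⟨i₀, hi₀⟩ := Function.ne_iff.mp hx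
  obtain ⟨i, hi, hmin⟩ : ∃ i, x i ≠ 0 ∧ ∀ j < i, x j = 0 := by
    have hne : (Finset.univ.filter fun i => x i ≠ 0).Nonempty := ⟨i₀, by simpa using hi₀⟩
    refine ⟨_, (Finset.mem_filter.mp (Finset.min'_mem _ hne)).2, fun j hj => ?_⟩
    by_contra h
    exact absurd (Finset.min'_le _ j (by simpa using h)) (not_le.mpr hj)
  have h1 : List.ofFn x = (List.ofFn x).take i ++ x i :: (List.ofFn x).drop (i + 1) := by
    conv_lhs => rw [← List.take_append_drop (i : ℕ) (List.ofFn x)]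
    rw [List.drop_eq_getElem_cons (by simp)]
    simp
  have h2 : ((List.ofFn x).take i).filter (fun a => decide (a ≠ 0)) = [] := by
    rw [List.filter_eq_nil_iff]
    intro a ha
    obtain ⟨k, hk, rfl⟩ := List.mem_iff_getElem.mp ha
    have hk' : k < i := by simp at hk; omega
    simpa using hmin ⟨k, by omega⟩ (by exact_mod_cast hk')
  have h3 : (List.ofFn x).drop i = x i :: (List.ofFn x).drop (i + 1) := by
    rw [List.drop_eq_getElem_cons (by simp)]
    simp
  refine ⟨i, ((List.ofFn x).drop (i + 1)).filter (fun a => decide (a ≠ 0)), hi, ?_, ?_⟩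
  · rw [h1, List.filter_append, h2, ← h1, List.filter_cons]
    simp [hi]
  · rw [cycleFrom, List.rotate_eq_drop_append_take (by simp), h3, List.filter_append,
      List.filter_append, h2, List.filter_cons]
    simp [hi]

/-- Closing the cycle adds a sign change exactly if the number of changes before was odd. -/
theorem cyclicVariation_eq_variation_add {m : ℕ} (x : Fin m → ℝ) :
    cyclicVariation x = variation (List.ofFn x) + variation (List.ofFn x) % 2 := by
  by_cases hx : x = 0
  · subst hx
    have : (List.ofFn (0 : Fin m → ℝ)).filter (fun a => decide (a ≠ 0)) = [] := by
      rw [List.filter_eq_nil_iff]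
      simp [List.mem_ofFn]
    rw [variation, this]
    simp [cyclicVariation, adjacentChanges]
  obtain ⟨i, q, hi, h1, h2⟩ := exists_filter_cycleFrom x hx
  rw [cyclicVariation_eq x hi]
  have hq : ∀ y ∈ q, y ≠ 0 := fun y hy => by
    have : y ∈ (List.ofFn x).filter (fun a => decide (a ≠ 0)) := by rw [h1]; simp [hy]
    simpa using (List.mem_filter.mp this).2
  unfold variation
  rw [h1, h2]
  rcases List.eq_nil_or_concat q with rfl | ⟨q, b, rfl⟩
  · have : ¬ x i * x i < 0 := not_lt.mpr (mul_self_nonneg _)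
    simp [adjacentChanges, this]
  · rw [List.concat_eq_append] at hq ⊢
    have hb : b ≠ 0 := hq b (by simp)
    have hpar := neg_one_pow_adjacentChanges b hb q (fun y hy => hq y (by simp [hy])) (x i) hi
    have hs := adjacentChanges_split b [x i] (x i :: q)
    have e1 : x i :: (q ++ [b] ++ [x i]) = (x i :: q) ++ b :: [x i] := by simp
    have e2 : x i :: (q ++ [b]) = x i :: q ++ [b] := by simp
    rw [e1, e2, hs]
    rw [e2] at hpar
    congr 1
    rcases Nat.even_or_odd (adjacentChanges (x i :: q ++ [b])) with h | h
    · rw [h.neg_one_pow, one_mul, mul_comm] at hpar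
      rw [Nat.even_iff.mp h]
      simp [adjacentChanges, not_lt.mpr hpar.le]
    · rw [h.neg_one_pow, mul_comm (x i)] at hpar
      have : b * x i < 0 := by linarith
      rw [Nat.odd_iff.mp h]
      simp [adjacentChanges, this]

theorem even_cyclicVariation {m : ℕ} (x : Fin m → ℝ) : Even (cyclicVariation x) := by
  rw [cyclicVariation_eq_variation_add, Nat.even_iff]
  omega

/-- `x` alternates in sign, strictly, along `v̊(x)` increasing indices. -/
theorem exists_alternating {m : ℕ} (x : Fin m → ℝ) :
    ∃ (e : Fin (cyclicVariation x) → Fin m) (s : ℝ), StrictMono e ∧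
      ∀ i : Fin (cyclicVariation x), 0 < s * (-1) ^ (i : ℕ) * x (e i) := by
  by_cases hx : x = 0
  · have h0 : cyclicVariation x = 0 := by simp [cyclicVariation, hx]
    have : IsEmpty (Fin (cyclicVariation x)) := by rw [h0]; infer_instance
    exact ⟨isEmptyElim, 1, fun i => isEmptyElim i, fun i => isEmptyElim i⟩
  obtain ⟨i, q, hi, h1, -⟩ := exists_filter_cycleFrom x hx
  have hq : ∀ y ∈ q, y ≠ 0 := fun y hy => by
    have : y ∈ (List.ofFn x).filter (fun a => decide (a ≠ 0)) := by rw [h1]; simp [hy]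
    simpa using (List.mem_filter.mp this).2
  obtain ⟨l, hl, hc, hlen⟩ := exists_isChain_sublist q hq (x i) hi
  have hsub : (x i :: l).Sublist (List.ofFn x) :=
    (hl.cons_cons (x i)).trans (h1 ▸ List.filter_sublist)
  obtain ⟨f, hf⟩ := List.sublist_iff_exists_fin_orderEmbedding_get_eq.mp hsub
  have hle : cyclicVariation x ≤ (x i :: l).length := by
    rw [cyclicVariation_eq_variation_add, variation, h1, List.length_cons, hlen]
    omega
  refine ⟨fun k => Fin.cast (by simp) (f (Fin.castLE hle k)), x i, fun j k hjk => ?_, fun k => ?_⟩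
  · have := f.strictMono (show Fin.castLE hle j < Fin.castLE hle k from hjk)
    exact this
  · have h3 := isChain_sign l (x i) hi hc k (k.2.trans_le hle)
    have h4 := hf (Fin.castLE hle k)
    simp only [List.get_eq_getElem, List.getElem_ofFn, Fin.val_castLE] at h4
    rw [h4] at h3
    exact h3

/-- The converse of `exists_alternating`: an even number of alternating terms is a lower bound. -/
theorem le_cyclicVariation {m k : ℕ} (hk : Even k) (x : Fin m → ℝ) (e : Fin k → Fin m)
    (he : StrictMono e) (s : ℝ) (hs : ∀ i : Fin k, 0 < s * (-1) ^ (i : ℕ) * x (e i)) :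
    k ≤ cyclicVariation x := by
  rcases k with _ | k
  · exact Nat.zero_le _
  have hs2 : 0 < s * s := mul_self_pos.mpr fun h => by simpa [h] using hs 0
  have hsub : (List.ofFn fun i => x (e i)).Sublist (List.ofFn x) := by
    rw [List.sublist_iff_exists_fin_orderEmbedding_get_eq]
    refine ⟨OrderEmbedding.ofStrictMono
      (fun i => Fin.cast (by simp) (e (Fin.cast (by simp) i))) ?_, ?_⟩
    · intro i j hij
      exact he (show Fin.cast (by simp) i < Fin.cast (by simp) j from hij)
    · intro i
      simp only [List.get_eq_getElem, List.getElem_ofFn]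
      rfl
  have hch : (List.ofFn fun i => x (e i)).IsChain (fun x y => x * y < 0) := by
    rw [List.isChain_iff_getElem]
    intro i hi
    have hi' : i + 1 < k + 1 := by simpa using hi
    have h1 := hs ⟨i, by omega⟩
    have h2 := hs ⟨i + 1, hi'⟩
    simp only [List.getElem_ofFn]
    have h3 := mul_pos h1 h2
    have h4 : ((-1 : ℝ) ^ i) ^ 2 = 1 := by rw [← pow_mul, mul_comm, pow_mul]; simp
    have h5 : s * (-1) ^ i * x (e ⟨i, by omega⟩) * (s * (-1) ^ (i + 1) * x (e ⟨i + 1, hi'⟩))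
        = (s * s) * -(x (e ⟨i, by omega⟩) * x (e ⟨i + 1, hi'⟩)) := by
      rw [pow_succ]
      linear_combination (-(s * s) * (x (e ⟨i, by omega⟩) * x (e ⟨i + 1, hi'⟩))) * h4
    rw [h5] at h3
    linarith [(pos_iff_pos_of_mul_pos h3).mp hs2]
  have hv := variation_le_of_sublist hsub
  have hne : ∀ y ∈ List.ofFn fun i => x (e i), y ≠ 0 := by
    intro y hy
    obtain ⟨i, rfl⟩ := (List.mem_ofFn' _ _).mp hy
    intro h
    have := hs i
    simp only at h
    simp [h] at this
  rw [variation, List.filter_eq_self.mpr (fun y hy => by simpa using hne y hy), List.ofFn_succ]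
    at hv
  rw [List.ofFn_succ] at hch
  rw [adjacentChanges_of_isChain _ _ hch, List.length_ofFn] at hv
  rw [Nat.even_iff] at hk
  rw [cyclicVariation_eq_variation_add]
  omega

/-- The counter of sign changes: a nondecreasing function of the index, at most `v̊(x)`, whose
parity is the sign of `x`. -/
theorem exists_monotone_sign {m : ℕ} (x : Fin m → ℝ) :
    ∃ (t : Fin m → ℕ) (s : ℝ), s ≠ 0 ∧ Monotone t ∧ (∀ j, t j ≤ cyclicVariation x) ∧
      ∀ j, 0 ≤ s * (-1) ^ t j * x j := by
  by_cases hx : x = 0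
  · exact ⟨fun _ => 0, 1, one_ne_zero, fun _ _ _ => le_rfl, fun _ => Nat.zero_le _, by simp [hx]⟩
  obtain ⟨i, q, hi, h1, -⟩ := exists_filter_cycleFrom x hx
  refine ⟨fun j => variation ((List.ofFn x).take (j + 1)), x i, hi, fun j k hjk => ?_,
    fun j => ?_, fun j => ?_⟩
  · exact variation_le_of_sublist (List.take_sublist_take_left
      (Nat.add_le_add_right (show (j : ℕ) ≤ k from hjk) 1))
  · rw [cyclicVariation_eq_variation_add]
    exact (variation_le_of_sublist (List.take_sublist _ _)).trans (Nat.le_add_right _ _)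
  · by_cases hj : x j = 0
    · simp [hj]
    have h2 : (List.ofFn x).take (j + 1) = (List.ofFn x).take j ++ [x j] := by
      rw [List.take_succ_eq_append_getElem (by simp)]
      simp
    have h3 : ((List.ofFn x).take (j + 1)).filter (fun a => decide (a ≠ 0)) =
        ((List.ofFn x).take j).filter (fun a => decide (a ≠ 0)) ++ [x j] := by
      rw [h2, List.filter_append]; simp [hj]
    have h4 : ((List.ofFn x).take (j + 1)).filter (fun a => decide (a ≠ 0)) <+: x i :: q := by
      rw [← h1]
      exact (List.take_prefix _ _).filter _
    simp only [variation]
    rw [h3]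
    rw [h3] at h4
    rcases hp : ((List.ofFn x).take j).filter (fun a => decide (a ≠ 0)) with _ | ⟨a, p⟩
    · rw [hp] at h4
      have : x j = x i := by
        obtain ⟨r, hr⟩ := h4
        simpa using (List.cons.inj hr).1
      simpa [adjacentChanges, this] using mul_self_nonneg (x i)
    · rw [hp] at h4
      have ha : a = x i := by
        obtain ⟨r, hr⟩ := h4
        simpa using (List.cons.inj hr).1
      have := neg_one_pow_adjacentChanges (x j) hj p (fun y hy => ?_) a (ha ▸ hi)
      · rw [ha] at this
        rw [List.cons_append, ha]
        linarith
      · have : y ∈ ((List.ofFn x).take j).filter (fun a => decide (a ≠ 0)) := by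
          rw [hp]; simp [hy]
        simpa using (List.mem_filter.mp this).2

theorem cyclicVariation_le {m : ℕ} (x : Fin m → ℝ) : cyclicVariation x ≤ m := by
  obtain ⟨e, -, he, -⟩ := exists_alternating x
  simpa using Fintype.card_le_of_injective e he.injective

/-- A sequence that does not take both signs has no cyclic variation. -/
theorem cyclicVariation_eq_zero {m : ℕ} (x : Fin m → ℝ) (s : ℝ) (hs : s ≠ 0)
    (h : ∀ i, 0 ≤ s * x i) : cyclicVariation x = 0 := by
  by_contra hne
  have h2 : 2 ≤ cyclicVariation x := by
    have := Nat.even_iff.mp (even_cyclicVariation x)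
    omega
  obtain ⟨e, r, -, hr⟩ := exists_alternating x
  have h0 := hr ⟨0, by omega⟩
  have h1 := hr ⟨1, by omega⟩
  simp only [pow_zero, pow_one, mul_one, mul_neg, neg_mul] at h0 h1
  have g0 := h (e ⟨0, by omega⟩)
  have g1 := h (e ⟨1, by omega⟩)
  rcases lt_or_gt_of_ne hs with hs | hs <;> rcases lt_trichotomy r 0 with hr | hr | hr <;>
    first
    | (subst hr; simp at h0)
    | nlinarith

/-! ### Counting zeros on the circle -/

/-- The number of points of a `2π`-periodic set is the same in every half-open period. -/
theorem encard_inter_Ico_le_of_periodic {P : Set ℝ}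
    (hP : Function.Periodic (fun u => u ∈ P) (2 * Real.pi)) (a b : ℝ) :
    (Set.Ico a (a + 2 * Real.pi) ∩ P).encard ≤ (Set.Ico b (b + 2 * Real.pi) ∩ P).encard := by
  have hp : 0 < 2 * Real.pi := Real.two_pi_pos
  refine Set.encard_le_encard_of_injOn (f := toIcoMod hp b) (fun u hu => ⟨?_, ?_⟩) ?_
  · exact toIcoMod_mem_Ico hp b u
  · have := hP.sub_zsmul_eq (x := u) (toIcoDiv hp b u)
    simp only [eq_iff_iff] at this
    exact this.mpr hu.2
  · intro u hu v hv huv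
    have h : ∀ w ∈ Set.Ico a (a + 2 * Real.pi), toIcoMod hp a (toIcoMod hp b w) = w :=
        fun w hw => by
      rw [toIcoMod_toIcoMod, toIcoMod_eq_self hp]
      exact hw
    rw [← h u hu.1, ← h v hv.1, huv]

theorem zeroCount_eq_encard {g : ℝ → ℝ} (hg : ∀ u, g (u + 2 * Real.pi) = 0 ↔ g u = 0) (ξ : ℝ) :
    zeroCount g = (Set.Ico ξ (ξ + 2 * Real.pi) ∩ {u | g u = 0}).encard := by
  have hP : Function.Periodic (fun u => u ∈ {u | g u = 0}) (2 * Real.pi) :=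
    fun u => propext (hg u)
  have h0 : zeroCount g = (Set.Ico 0 (0 + 2 * Real.pi) ∩ {u | g u = 0}).encard := by
    rw [zeroCount, zero_add]
    rfl
  rw [h0]
  exact le_antisymm (encard_inter_Ico_le_of_periodic hP _ _)
    (encard_inter_Ico_le_of_periodic hP _ _)

open Classical in
/-- Zeros on the circle, counted on the circle cut open at `ξ`. -/
theorem zeroCount_eq_encard_Ioo_add {g : ℝ → ℝ}
    (hg : ∀ u, g (u + 2 * Real.pi) = 0 ↔ g u = 0) (ξ : ℝ) :
    zeroCount g = (Set.Ioo ξ (ξ + 2 * Real.pi) ∩ {u | g u = 0}).encard +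
      if g ξ = 0 then 1 else 0 := by
  have hlt : ξ < ξ + 2 * Real.pi := by linarith [Real.two_pi_pos]
  rw [zeroCount_eq_encard hg ξ, ← Set.Ioo_insert_left hlt]
  split_ifs with h
  · rw [Set.insert_inter_of_mem (by exact h), Set.encard_insert_of_notMem (by simp)]
  · rw [Set.insert_inter_of_notMem (by exact h), add_zero]

/-- Rolle's theorem, counting zeros in an open interval. -/
theorem encard_zeros_le_encard_zeros_deriv_add_one {h h' : ℝ → ℝ} {a b : ℝ}
    (hd : ∀ u ∈ Set.Ioo a b, HasDerivAt h (h' u) u) :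
    (Set.Ioo a b ∩ {u | h u = 0}).encard ≤ (Set.Ioo a b ∩ {u | h' u = 0}).encard + 1 := by
  by_contra hlt
  rw [not_le] at hlt
  have hfin : (Set.Ioo a b ∩ {u | h' u = 0}).Finite := by
    rw [← Set.encard_lt_top_iff]
    exact lt_of_le_of_lt le_self_add (hlt.trans_le le_top)
  have hle : (Set.Ioo a b ∩ {u | h' u = 0}).encard + 1 + 1 ≤
      (Set.Ioo a b ∩ {u | h u = 0}).encard := Order.add_one_le_of_lt hlt
  obtain ⟨S, hS, hSc⟩ := Set.exists_subset_encard_eq hle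
  have hSfin : S.Finite := by
    rw [← Set.encard_lt_top_iff, hSc, hfin.encard_eq_coe_toFinset_card]
    exact_mod_cast ENat.natCast_lt_top (_ + 1 + 1)
  have hcard : hSfin.toFinset.card ≤ hfin.toFinset.card + 1 := by
    refine Finset.card_le_of_interleaved fun x hx y hy hxy _ => ?_
    have hx' := hS (hSfin.mem_toFinset.mp hx)
    have hy' := hS (hSfin.mem_toFinset.mp hy)
    have hsub : ∀ z ∈ Set.Icc x y, z ∈ Set.Ioo a b := fun z hz =>
      ⟨hx'.1.1.trans_le hz.1, hz.2.trans_lt hy'.1.2⟩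
    obtain ⟨z, hz, hz0⟩ := exists_hasDerivAt_eq_zero hxy
      (fun z hz => (hd z (hsub z hz)).continuousAt.continuousWithinAt)
      ((show h x = 0 from hx'.2).trans (show h y = 0 from hy'.2).symm)
      (fun z hz => hd z (hsub z (Set.Ioo_subset_Icc_self hz)))
    exact ⟨z, hfin.mem_toFinset.mpr ⟨hsub z (Set.Ioo_subset_Icc_self hz), hz0⟩, hz.1, hz.2⟩
  rw [hSfin.encard_eq_coe_toFinset_card, hfin.encard_eq_coe_toFinset_card] at hSc
  have : hSfin.toFinset.card = hfin.toFinset.card + 1 + 1 := by exact_mod_cast hSc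
  omega

/-! ### Sums of powers of sines -/

/-- The sum `∑ b_j sin((u - θ_j)/2)^m`. In the coordinate `tan (u/2)` it is, up to a common factor,
a sum of `m`-th powers of real linear forms. -/
noncomputable def sinPowerSum {ι : Type*} [Fintype ι] (θ : ι → ℝ) (m : ℕ) (b : ι → ℝ) (u : ℝ) : ℝ :=
  ∑ j, b j * Real.sin ((u - θ j) / 2) ^ m

section

variable {ι : Type*} [Fintype ι] (θ : ι → ℝ)

theorem sinPowerSum_add_two_pi (m : ℕ) (b : ι → ℝ) (u : ℝ) :
    sinPowerSum θ m b (u + 2 * Real.pi) = (-1) ^ m * sinPowerSum θ m b u := by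
  rw [sinPowerSum, sinPowerSum, Finset.mul_sum]
  refine Finset.sum_congr rfl fun j _ => ?_
  have : (u + 2 * Real.pi - θ j) / 2 = (u - θ j) / 2 + Real.pi := by ring
  rw [this, Real.sin_add_pi, neg_pow]
  ring

theorem sinPowerSum_add_two_pi_eq_zero_iff (m : ℕ) (b : ι → ℝ) (u : ℝ) :
    sinPowerSum θ m b (u + 2 * Real.pi) = 0 ↔ sinPowerSum θ m b u = 0 := by
  rw [sinPowerSum_add_two_pi]
  simp

theorem hasDerivAt_sin_div_sin (τ ξ u : ℝ) (hu : Real.sin ((u - ξ) / 2) ≠ 0) :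
    HasDerivAt (fun u => Real.sin ((u - τ) / 2) / Real.sin ((u - ξ) / 2))
      (Real.sin ((τ - ξ) / 2) / (2 * Real.sin ((u - ξ) / 2) ^ 2)) u := by
  have h (σ : ℝ) : HasDerivAt (fun u => Real.sin ((u - σ) / 2))
      (Real.cos ((u - σ) / 2) * (1 / 2)) u :=
    (((hasDerivAt_id u).sub_const σ).div_const 2).sin
  refine ((h τ).fun_div (h ξ) hu).congr_deriv ?_
  have : (τ - ξ) / 2 = (u - ξ) / 2 - (u - τ) / 2 := by ring
  rw [this, Real.sin_sub]
  field_simp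

/-- Cutting the circle at `ξ` and dividing by `sin((u - ξ)/2)^(m+1)` turns differentiation into the
polar derivative: the exponent drops by one and the coefficients are multiplied by
`sin((θ_j - ξ)/2)`. -/
theorem hasDerivAt_sinPowerSum_div (m : ℕ) (b : ι → ℝ) (ξ u : ℝ)
    (hu : Real.sin ((u - ξ) / 2) ≠ 0) :
    HasDerivAt (fun u => sinPowerSum θ (m + 1) b u / Real.sin ((u - ξ) / 2) ^ (m + 1))
      ((m + 1) / (2 * Real.sin ((u - ξ) / 2) ^ (m + 2)) *
        sinPowerSum θ m (fun j => b j * Real.sin ((θ j - ξ) / 2)) u) u := by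
  have h := HasDerivAt.fun_sum (u := Finset.univ) fun j _ =>
    ((hasDerivAt_sin_div_sin (θ j) ξ u hu).fun_pow (m + 1)).const_mul (b j)
  have e : (fun u => sinPowerSum θ (m + 1) b u / Real.sin ((u - ξ) / 2) ^ (m + 1)) = fun u =>
      ∑ j, b j * (Real.sin ((u - θ j) / 2) / Real.sin ((u - ξ) / 2)) ^ (m + 1) := by
    ext v
    rw [sinPowerSum, Finset.sum_div]
    exact Finset.sum_congr rfl fun j _ => by rw [div_pow, mul_div_assoc]
  rw [e]
  refine h.congr_deriv ?_
  · rw [sinPowerSum, Finset.mul_sum]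
    refine Finset.sum_congr rfl fun j _ => ?_
    rw [Nat.add_sub_cancel, div_pow, pow_add]
    push_cast
    field_simp

theorem zeroCount_sinPowerSum_succ_le (m : ℕ) (b : ι → ℝ) (ξ : ℝ) :
    zeroCount (sinPowerSum θ (m + 1) b) ≤
      zeroCount (sinPowerSum θ m fun j => b j * Real.sin ((θ j - ξ) / 2)) + 1 := by
  classical
  rw [zeroCount_eq_encard_Ioo_add (sinPowerSum_add_two_pi_eq_zero_iff θ _ _) ξ,
    zeroCount_eq_encard_Ioo_add (sinPowerSum_add_two_pi_eq_zero_iff θ _ _) ξ]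
  have hsin : ∀ u ∈ Set.Ioo ξ (ξ + 2 * Real.pi), Real.sin ((u - ξ) / 2) ≠ 0 := fun u hu =>
    (Real.sin_pos_of_pos_of_lt_pi (by linarith [hu.1]) (by linarith [hu.2])).ne'
  have hrolle := encard_zeros_le_encard_zeros_deriv_add_one fun u hu =>
    hasDerivAt_sinPowerSum_div θ m b ξ u (hsin u hu)
  have e1 : Set.Ioo ξ (ξ + 2 * Real.pi) ∩
      {u | sinPowerSum θ (m + 1) b u / Real.sin ((u - ξ) / 2) ^ (m + 1) = 0} =
      Set.Ioo ξ (ξ + 2 * Real.pi) ∩ {u | sinPowerSum θ (m + 1) b u = 0} := by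
    ext u
    refine and_congr_right fun hu => ?_
    simp [hsin u hu]
  have e2 : Set.Ioo ξ (ξ + 2 * Real.pi) ∩
      {u | (m + 1) / (2 * Real.sin ((u - ξ) / 2) ^ (m + 2)) *
        sinPowerSum θ m (fun j => b j * Real.sin ((θ j - ξ) / 2)) u = 0} =
      Set.Ioo ξ (ξ + 2 * Real.pi) ∩
        {u | sinPowerSum θ m (fun j => b j * Real.sin ((θ j - ξ) / 2)) u = 0} := by
    ext u
    refine and_congr_right fun hu => ?_
    have : (m : ℝ) + 1 ≠ 0 := by positivity
    simp [hsin u hu, this]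
  rw [e1, e2] at hrolle
  -- A zero at the cut is not seen by Rolle's theorem, but the polar derivative inherits it.
  have hcut : sinPowerSum θ m (fun j => b j * Real.sin ((θ j - ξ) / 2)) ξ =
      -sinPowerSum θ (m + 1) b ξ := by
    rw [sinPowerSum, sinPowerSum, ← Finset.sum_neg_distrib]
    refine Finset.sum_congr rfl fun j _ => ?_
    have : (θ j - ξ) / 2 = -((ξ - θ j) / 2) := by ring
    rw [this, Real.sin_neg, pow_succ]
    ring
  simp only [hcut, neg_eq_zero]
  rw [add_right_comm]
  gcongr

theorem zeroCount_sinPowerSum_add_length_le (L : List ℝ) (m : ℕ) (b : ι → ℝ) :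
    zeroCount (sinPowerSum θ (m + L.length) b) ≤
      zeroCount (sinPowerSum θ m fun j => b j * (L.map fun ξ => Real.sin ((θ j - ξ) / 2)).prod) +
        L.length := by
  induction L generalizing b with
  | nil => simp
  | cons ξ L ih =>
    have h1 := zeroCount_sinPowerSum_succ_le θ (m + L.length) b ξ
    have h2 := ih fun j => b j * Real.sin ((θ j - ξ) / 2)
    simp only [List.length_cons, List.map_cons, List.prod_cons, ← mul_assoc] at h2 ⊢
    rw [← add_assoc m]
    refine h1.trans ?_
    push_cast
    rw [← add_assoc]
    gcongr

/-- Even powers with nonnegative coefficients, two of them positive at different angles, have no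
common zero. -/
theorem zeroCount_sinPowerSum_eq_zero {m : ℕ} (hm : Even m) (b : ι → ℝ) (s : ℝ)
    (hb : ∀ j, 0 ≤ s * b j) {i j : ι} (hi : b i ≠ 0) (hj : b j ≠ 0) (hs : s ≠ 0)
    (hij : m = 0 ∨ Real.sin ((θ i - θ j) / 2) ≠ 0) :
    zeroCount (sinPowerSum θ m b) = 0 := by
  rw [zeroCount, Set.encard_eq_zero, Set.eq_empty_iff_forall_notMem]
  rintro u ⟨-, hu⟩
  have h0 : ∑ k, s * b k * Real.sin ((u - θ k) / 2) ^ m = 0 := by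
    have : ∑ k, s * b k * Real.sin ((u - θ k) / 2) ^ m = s * sinPowerSum θ m b u := by
      rw [sinPowerSum, Finset.mul_sum]
      exact Finset.sum_congr rfl fun k _ => by ring
    rw [this, hu, mul_zero]
  rw [Finset.sum_eq_zero_iff_of_nonneg fun k _ => mul_nonneg (hb k) (hm.pow_nonneg _)] at h0
  have hz : ∀ k, b k ≠ 0 → Real.sin ((u - θ k) / 2) ^ m = 0 := fun k hk =>
    (mul_eq_zero.mp (h0 k (Finset.mem_univ k))).resolve_left (mul_ne_zero hs hk)
  rcases hij with rfl | hij
  · simpa using hz i hi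
  · have e : (θ i - θ j) / 2 = (u - θ j) / 2 - (u - θ i) / 2 := by ring
    apply hij
    rw [e, Real.sin_sub, eq_zero_of_pow_eq_zero (hz i hi), eq_zero_of_pow_eq_zero (hz j hj)]
    ring

end

/-! ### The basis densities -/

/-- The angles `2πj/(2n+1) - π` at which the basis densities vanish. -/
noncomputable def zeroAngle (n : ℕ) (j : Fin (2 * n + 1)) : ℝ :=
  2 * Real.pi * (j : ℝ) / (2 * (n : ℝ) + 1) - Real.pi

theorem basisDensity_eq_sin_pow (n : ℕ) (j : Fin (2 * n + 1)) (u : ℝ) :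
    basisDensity n j u = 2 ^ (2 * n) / (2 * Real.pi * ((2 * n).choose n : ℝ)) *
      Real.sin ((u - zeroAngle n j) / 2) ^ (2 * n) := by
  rw [basisDensity, pow_mul (Real.sin _)]
  congr 2
  have h : u - 2 * Real.pi * (j : ℝ) / (2 * (n : ℝ) + 1) =
      2 * ((u - zeroAngle n j) / 2) - Real.pi := by
    rw [zeroAngle]; ring
  rw [h, Real.cos_sub_pi, Real.cos_two_mul']
  linarith [Real.sin_sq_add_cos_sq ((u - zeroAngle n j) / 2)]

theorem basisDensity_coeff_pos (n : ℕ) :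
    (0 : ℝ) < 2 ^ (2 * n) / (2 * Real.pi * ((2 * n).choose n : ℝ)) := by
  have := Nat.choose_pos (show n ≤ 2 * n by omega)
  have := Real.pi_pos
  positivity

theorem basisDensity_nonneg (n : ℕ) (j : Fin (2 * n + 1)) (u : ℝ) : 0 ≤ basisDensity n j u := by
  rw [basisDensity_eq_sin_pow]
  exact mul_nonneg (basisDensity_coeff_pos n).le ((even_two_mul n).pow_nonneg _)

theorem sum_basisDensity_mul (n : ℕ) (a : Fin (2 * n + 1) → ℝ) (u : ℝ) :
    ∑ j, a j * basisDensity n j u = 2 ^ (2 * n) / (2 * Real.pi * ((2 * n).choose n : ℝ)) *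
      sinPowerSum (zeroAngle n) (2 * n) a u := by
  rw [sinPowerSum, Finset.mul_sum]
  exact Finset.sum_congr rfl fun j _ => by rw [basisDensity_eq_sin_pow]; ring

theorem basisDensity_periodic (n : ℕ) (j : Fin (2 * n + 1)) :
    Function.Periodic (basisDensity n j) (2 * Real.pi) := fun u => by
  rw [basisDensity, basisDensity, add_sub_right_comm, Real.cos_add_two_pi]

theorem mixture_periodic (n : ℕ) (c : Fin (2 * n + 1) → ℝ) :
    Function.Periodic (mixture n c) (2 * Real.pi) := fun u => by
  simp only [mixture, (basisDensity_periodic n _) u]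

/-- Summing over the `(2n+1)`-st roots of unity extracts the middle coefficient of
`(1 + w)^(2n)`. -/
theorem sum_one_add_pow_mul_rootsOfUnity (n : ℕ) {ω : ℂ} (hω : IsPrimitiveRoot ω (2 * n + 1))
    (w : ℂ) : ∑ j ∈ Finset.range (2 * n + 1), (1 + w * ω ^ j) ^ (2 * n) * (ω ^ j) ^ (n + 1) =
      (2 * n + 1) * (2 * n).choose n * w ^ n := by
  have h1 : ∀ j, (1 + w * ω ^ j) ^ (2 * n) * (ω ^ j) ^ (n + 1) =
      ∑ k ∈ Finset.range (2 * n + 1),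
        ((2 * n).choose k : ℂ) * w ^ k * (ω ^ (k + (n + 1))) ^ j := fun j => by
    rw [add_comm, add_pow, Finset.sum_mul]
    refine Finset.sum_congr rfl fun k _ => ?_
    rw [one_pow, mul_pow, ← pow_mul ω (k + _), mul_comm (k + (n + 1)) j, pow_mul, pow_add]
    ring
  simp only [h1]
  rw [Finset.sum_comm]
  simp only [← Finset.mul_sum]
  rw [Finset.sum_eq_single n]
  · have : ω ^ (n + (n + 1)) = 1 := by rw [show n + (n + 1) = 2 * n + 1 by ring, hω.pow_eq_one]
    simp only [this, one_pow, Finset.sum_const, Finset.card_range, nsmul_eq_mul]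
    push_cast
    ring
  · intro k hk hkn
    have hk : k < 2 * n + 1 := Finset.mem_range.mp hk
    have hne : ω ^ (k + (n + 1)) ≠ 1 := by
      rw [Ne, hω.pow_eq_one_iff_dvd]
      rintro ⟨r, hr⟩
      have h3 : r < 2 := by by_contra h; nlinarith
      interval_cases r <;> omega
    have := mul_geom_sum (ω ^ (k + (n + 1))) (2 * n + 1)
    rw [← pow_mul, mul_comm (k + (n + 1)), pow_mul, hω.pow_eq_one, one_pow, sub_self] at this
    rw [(mul_eq_zero.mp this).resolve_left (sub_ne_zero.mpr hne), mul_zero]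
  · intro h
    exact absurd (Finset.mem_range.mpr (by omega)) h

theorem sum_basisDensity (n : ℕ) (u : ℝ) :
    ∑ j, basisDensity n j u = (2 * (n : ℝ) + 1) / (2 * Real.pi) := by
  set ω : ℂ := Complex.exp (2 * Real.pi * Complex.I / ((2 * n + 1 : ℕ) : ℂ)) with hωdef
  have hω : IsPrimitiveRoot ω⁻¹ (2 * n + 1) :=
    (Complex.isPrimitiveRoot_exp (2 * n + 1) (by omega)).inv
  have hω0 : ω ≠ 0 := Complex.exp_ne_zero _
  set w : ℂ := Complex.exp (u * Complex.I)
  have hw0 : w ≠ 0 := Complex.exp_ne_zero _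
  have hterm : ∀ j : ℕ,
      ((((1 + Real.cos (u - 2 * Real.pi * (j : ℝ) / (2 * (n : ℝ) + 1))) / 2) ^ n : ℝ) : ℂ) =
        (1 + w * ω⁻¹ ^ j) ^ (2 * n) * (ω⁻¹ ^ j) ^ (n + 1) / (4 ^ n * w ^ n) := fun j => by
    have hz : Complex.exp (((u - 2 * Real.pi * (j : ℝ) / (2 * (n : ℝ) + 1) : ℝ) : ℂ) * Complex.I)
        = w * ω⁻¹ ^ j := by
      rw [hωdef, ← Complex.exp_neg, ← Complex.exp_nat_mul, ← Complex.exp_add]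
      congr 1
      push_cast
      ring
    have hz0 : w * ω⁻¹ ^ j ≠ 0 := mul_ne_zero hw0 (pow_ne_zero _ (inv_ne_zero hω0))
    have hpow : (ω⁻¹ ^ j) ^ (n + 1) * (ω⁻¹ ^ j) ^ n = 1 := by
      rw [← pow_add, show n + 1 + n = 2 * n + 1 by ring, ← pow_mul, mul_comm, pow_mul,
        hω.pow_eq_one, one_pow]
    push_cast
    rw [Complex.cos, ← neg_mul_eq_neg_mul, Complex.exp_neg]
    push_cast at hz
    rw [hz]
    generalize ω⁻¹ ^ j = y at *
    have hy0 : y ≠ 0 := right_ne_zero_of_mul hz0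
    have h4 : (4 : ℂ) ≠ 0 := by norm_num
    have e : (1 + (w * y + (w * y)⁻¹) / 2) / 2 = (1 + w * y) ^ 2 / (4 * (w * y)) := by
      field_simp
      ring
    rw [e, div_pow, ← pow_mul, mul_pow, mul_pow, div_eq_div_iff
      (mul_ne_zero (pow_ne_zero _ h4) (by rw [← mul_pow]; exact pow_ne_zero _ hz0))
      (mul_ne_zero (pow_ne_zero _ h4) (pow_ne_zero _ hw0))]
    linear_combination (-(1 + w * y) ^ (2 * n) * 4 ^ n * w ^ n) * hpow
  have hsum : ∑ j : Fin (2 * n + 1),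
      ((1 + Real.cos (u - 2 * Real.pi * (j : ℝ) / (2 * (n : ℝ) + 1))) / 2) ^ n =
        (2 * n + 1) * (2 * n).choose n / 4 ^ n := by
    have hsumC := sum_one_add_pow_mul_rootsOfUnity n hω w
    rw [← Fin.sum_univ_eq_sum_range
      (fun j => (1 + w * ω⁻¹ ^ j) ^ (2 * n) * (ω⁻¹ ^ j) ^ (n + 1))] at hsumC
    apply Complex.ofReal_injective
    rw [Complex.ofReal_sum]
    simp only [hterm]
    rw [← Finset.sum_div, hsumC]
    push_cast
    have : (4 : ℂ) ^ n ≠ 0 := pow_ne_zero _ (by norm_num)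
    field_simp
  simp only [basisDensity]
  rw [← Finset.mul_sum, hsum]
  have h1 : ((2 * n).choose n : ℝ) ≠ 0 := by
    exact_mod_cast (Nat.choose_pos (show n ≤ 2 * n by omega)).ne'
  have h2 : (4 : ℝ) ^ n = 2 ^ (2 * n) := by rw [pow_mul]; norm_num
  have h3 : (2 : ℝ) ^ (2 * n) ≠ 0 := by positivity
  have h4 := Real.pi_pos.ne'
  rw [h2]
  field_simp

/-- Subtracting a constant from a mixture subtracts a constant from its coefficients, because the
basis densities form a partition of a constant. -/
theorem mixture_sub (n : ℕ) (c : Fin (2 * n + 1) → ℝ) (α u : ℝ) :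
    mixture n c u - α = 2 * Real.pi / (2 * n + 1) *
      ∑ j, (scaledCoeff n c j - α) * basisDensity n j u := by
  have h := sum_basisDensity n u
  have hn : (2 * (n : ℝ) + 1) ≠ 0 := by positivity
  have hpi := Real.pi_pos.ne'
  simp only [sub_mul, Finset.sum_sub_distrib, ← Finset.mul_sum, h, scaledCoeff, mul_assoc]
  rw [mixture]
  field_simp

theorem mixture_sub_eq_sinPowerSum (n : ℕ) (c : Fin (2 * n + 1) → ℝ) (α u : ℝ) :
    mixture n c u - α = (2 * Real.pi / (2 * n + 1) *
      (2 ^ (2 * n) / (2 * Real.pi * ((2 * n).choose n : ℝ)))) *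
        sinPowerSum (zeroAngle n) (2 * n) (fun j => scaledCoeff n c j - α) u := by
  rw [mixture_sub, sum_basisDensity_mul]
  exact (mul_assoc _ _ _).symm

/-! ### Zeros are bounded by sign changes of the coefficients -/

theorem le_iff_lt_card_of_monotone {N : ℕ} {t : Fin N → ℕ} (ht : Monotone t) (i : ℕ) (j : Fin N) :
    t j ≤ i ↔ (j : ℕ) < (Finset.univ.filter fun k => t k ≤ i).card := by
  constructor
  · intro h
    have : Finset.Iic j ⊆ Finset.univ.filter fun k => t k ≤ i := fun k hk => by
      simpa using (ht (Finset.mem_Iic.mp hk)).trans h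
    have := Finset.card_le_card this
    rw [Fin.card_Iic] at this
    omega
  · intro h
    by_contra hlt
    have : (Finset.univ.filter fun k => t k ≤ i) ⊆ Finset.Iio j := fun k hk => by
      rw [Finset.mem_Iio]
      by_contra hjk
      exact hlt ((ht (not_lt.mp hjk)).trans (by simpa using hk))
    have := Finset.card_le_card this
    rw [Fin.card_Iio] at this
    omega

/-- A cut of the circle placed half a step before the first angle whose index `j` has `t j > i`, and
half a step after the last angle if there is no such index. -/
noncomputable def cutAngle {n : ℕ} (t : Fin (2 * n + 1) → ℕ) (i : ℕ) : ℝ :=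
  2 * Real.pi * (((Finset.univ.filter fun k => t k ≤ i).card : ℝ) - 1 / 2) / (2 * (n : ℝ) + 1) -
    Real.pi

theorem sin_pos_of_mul_pi_div {n : ℕ} {y : ℝ} (h0 : 0 < y) (h1 : y < 2 * (n : ℝ) + 1) :
    0 < Real.sin (Real.pi * y / (2 * n + 1)) := by
  have := Real.pi_pos
  refine Real.sin_pos_of_pos_of_lt_pi (by positivity) ?_
  rw [div_lt_iff₀ (by positivity)]
  exact mul_lt_mul_of_pos_left h1 this

/-- The first `r` cuts give the polar factor at `θ_j` the sign `(-1)^(r - t j)`: exactly the cuts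
numbered `i` with `t j ≤ i < r` lie after `θ_j`. The subtraction is truncated on purpose. -/
theorem neg_one_pow_mul_prod_sin_pos {n : ℕ} {t : Fin (2 * n + 1) → ℕ} (ht : Monotone t)
    (j : Fin (2 * n + 1)) (r : ℕ) :
    0 < (-1 : ℝ) ^ (r - t j) * (((List.range r).map (cutAngle t)).map
      fun ξ => Real.sin ((zeroAngle n j - ξ) / 2)).prod := by
  induction r with
  | zero => simp
  | succ r ih =>
    rw [List.range_succ, List.map_append, List.map_append, List.prod_append]
    simp only [List.map_cons, List.map_nil, List.prod_cons, List.prod_nil, mul_one]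
    have hkey := le_iff_lt_card_of_monotone ht r j
    have hc : (Finset.univ.filter fun k => t k ≤ r).card ≤ 2 * n + 1 :=
      (Finset.card_le_univ _).trans (by simp)
    have hj := j.2
    obtain ⟨C, hC⟩ : ∃ C, C = (Finset.univ.filter fun k => t k ≤ r).card := ⟨_, rfl⟩
    rw [← hC] at hc hkey
    have hc' : (C : ℝ) ≤ 2 * n + 1 := by exact_mod_cast hc
    have hj' : (j : ℝ) + 1 ≤ 2 * n + 1 := by exact_mod_cast hj
    have hj0 : (0 : ℝ) ≤ j := by positivity
    have hC0 : (0 : ℝ) ≤ C := by positivity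
    by_cases h : t j ≤ r
    · have hlt : (j : ℝ) + 1 ≤ C := by exact_mod_cast hkey.mp h
      have hs := sin_pos_of_mul_pi_div (n := n) (y := C - 1 / 2 - j) (by linarith) (by linarith)
      have e : (zeroAngle n j - cutAngle t r) / 2 =
          -(Real.pi * (C - 1 / 2 - j) / (2 * n + 1)) := by
        rw [cutAngle, zeroAngle, ← hC]; ring
      rw [Nat.succ_sub h, pow_succ, e, Real.sin_neg]
      calc 0 < _ := mul_pos ih hs
        _ = _ := by ring
    · have hlt : (C : ℝ) ≤ j := by exact_mod_cast not_lt.mp (fun h' => h (hkey.mpr h'))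
      have hs := sin_pos_of_mul_pi_div (n := n) (y := j - (C - 1 / 2)) (by linarith) (by linarith)
      have e : (zeroAngle n j - cutAngle t r) / 2 =
          Real.pi * (j - (C - 1 / 2)) / (2 * n + 1) := by
        rw [cutAngle, zeroAngle, ← hC]; ring
      rw [show r + 1 - t j = r - t j by omega, e]
      calc 0 < _ := mul_pos ih hs
        _ = _ := by ring

theorem sin_zeroAngle_sub_ne_zero {n : ℕ} {i j : Fin (2 * n + 1)} (h : i ≠ j) :
    Real.sin ((zeroAngle n i - zeroAngle n j) / 2) ≠ 0 := by
  have hi : (i : ℝ) + 1 ≤ 2 * n + 1 := by exact_mod_cast i.2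
  have hj : (j : ℝ) + 1 ≤ 2 * n + 1 := by exact_mod_cast j.2
  have hi0 : (0 : ℝ) ≤ (i : ℕ) := by positivity
  have hj0 : (0 : ℝ) ≤ (j : ℕ) := by positivity
  rw [zeroAngle, zeroAngle]
  rcases lt_or_gt_of_ne h with h | h
  · have h' : ((i : ℕ) : ℝ) < (j : ℕ) := by exact_mod_cast h
    have e : (2 * Real.pi * (i : ℝ) / (2 * n + 1) - Real.pi -
        (2 * Real.pi * (j : ℝ) / (2 * n + 1) - Real.pi)) / 2 =
        -(Real.pi * (j - i) / (2 * n + 1)) := by ring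
    rw [e, Real.sin_neg, neg_ne_zero]
    exact (sin_pos_of_mul_pi_div (by linarith) (by linarith)).ne'
  · have h' : ((j : ℕ) : ℝ) < (i : ℕ) := by exact_mod_cast h
    have e : (2 * Real.pi * (i : ℝ) / (2 * n + 1) - Real.pi -
        (2 * Real.pi * (j : ℝ) / (2 * n + 1) - Real.pi)) / 2 =
        Real.pi * (i - j) / (2 * n + 1) := by ring
    rw [e]
    exact (sin_pos_of_mul_pi_div (by linarith) (by linarith)).ne'

/-- A cyclic version of Sylvester's bound for sums of powers of real linear forms. -/
theorem zeroCount_sinPowerSum_zeroAngle_le (n : ℕ) (a : Fin (2 * n + 1) → ℝ)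
    (ha : (n = 0 ∧ a 0 ≠ 0) ∨ ∃ i j, i ≠ j ∧ a i ≠ 0 ∧ a j ≠ 0) :
    zeroCount (sinPowerSum (zeroAngle n) (2 * n) a) ≤ cyclicVariation a := by
  obtain ⟨t, s, hs, ht, htv, hsign⟩ := exists_monotone_sign a
  have hev := even_cyclicVariation a
  have hle := cyclicVariation_le a
  set v := cyclicVariation a
  -- `v` is even and at most the odd number `2n + 1`, hence at most the exponent `2n`.
  obtain ⟨m, hm⟩ : ∃ m, 2 * n = m + v := by
    rw [Nat.even_iff] at hev
    exact ⟨2 * n - v, by omega⟩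
  have hmev : Even m := by
    rw [Nat.even_iff] at hev ⊢
    omega
  have h := zeroCount_sinPowerSum_add_length_le (zeroAngle n) ((List.range v).map (cutAngle t)) m a
  rw [List.length_map, List.length_range, ← hm] at h
  refine h.trans ?_
  have hprod := fun j => neg_one_pow_mul_prod_sin_pos ht j v
  set p : Fin (2 * n + 1) → ℝ := fun j => (((List.range v).map (cutAngle t)).map
      fun ξ => Real.sin ((zeroAngle n j - ξ) / 2)).prod with hp
  have hpow : ∀ j, (-1 : ℝ) ^ (v - t j) = (-1) ^ t j := fun j => by
    have h1 : (-1 : ℝ) ^ (v - t j) * (-1) ^ t j = 1 := by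
      rw [← pow_add, Nat.sub_add_cancel (htv j), hev.neg_one_pow]
    have h2 : (-1 : ℝ) ^ t j * (-1) ^ t j = 1 := by rw [← mul_pow]; simp
    linear_combination (-1 : ℝ) ^ t j * h1 - (-1 : ℝ) ^ (v - t j) * h2
  have hnn : ∀ j, 0 ≤ s * (a j * p j) := fun j => by
    have h2 : (-1 : ℝ) ^ t j * (-1) ^ t j = 1 := by rw [← mul_pow]; simp
    have h1 := mul_nonneg (hsign j) (hprod j).le
    rw [hpow j] at h1
    calc 0 ≤ _ := h1
      _ = (-1 : ℝ) ^ t j * (-1) ^ t j * (s * (a j * p j)) := by rw [hp]; ring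
      _ = _ := by rw [h2, one_mul]
  have hne : ∀ j, a j ≠ 0 → a j * p j ≠ 0 := fun j hj =>
    mul_ne_zero hj (right_ne_zero_of_mul (hprod j).ne')
  have hz : zeroCount (sinPowerSum (zeroAngle n) m fun j => a j * p j) = 0 := by
    rcases ha with ⟨hn, ha0⟩ | ⟨i, j, hij, hi, hj⟩
    · exact zeroCount_sinPowerSum_eq_zero _ hmev _ s hnn (hne 0 ha0) (hne 0 ha0) hs
        (Or.inl (by omega))
    · exact zeroCount_sinPowerSum_eq_zero _ hmev _ s hnn (hne i hi) (hne j hj) hs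
        (Or.inr (sin_zeroAngle_sub_ne_zero hij))
  rw [hz, zero_add]

theorem zeroCount_mixture_sub_le (n : ℕ) (c : Fin (2 * n + 1) → ℝ) (α : ℝ)
    (h : (n = 0 ∧ scaledCoeff n c 0 ≠ α) ∨
      ∃ i j, i ≠ j ∧ scaledCoeff n c i ≠ α ∧ scaledCoeff n c j ≠ α) :
    zeroCount (fun u => mixture n c u - α) ≤ cyclicVariation fun j => scaledCoeff n c j - α := by
  have hne : 2 * Real.pi / (2 * n + 1) *
      (2 ^ (2 * n) / (2 * Real.pi * ((2 * n).choose n : ℝ))) ≠ 0 := by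
    have := basisDensity_coeff_pos n
    have := Real.pi_pos
    positivity
  have e : zeroCount (fun u => mixture n c u - α) =
      zeroCount (sinPowerSum (zeroAngle n) (2 * n) fun j => scaledCoeff n c j - α) := by
    simp only [zeroCount, mixture_sub_eq_sinPowerSum, mul_eq_zero, hne, false_or]
  rw [e]
  refine zeroCount_sinPowerSum_zeroAngle_le n _ ?_
  simpa only [sub_ne_zero] using h

/-! ### Sign changes and zeros of continuous periodic functions -/

theorem cyclicVariation_le_cyclicVariationFun (f : ℝ → ℝ) {m : ℕ} (hm : 2 ≤ m) {x : Fin m → ℝ}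
    (hx : StrictMono x) (hmem : ∀ i, x i ∈ Set.Ico (0 : ℝ) (2 * Real.pi)) :
    (cyclicVariation (fun i => f (x i)) : ℕ∞) ≤ cyclicVariationFun f :=
  le_iSup₂_of_le m hm <| le_iSup₂_of_le x hx <| le_iSup_of_le hmem le_rfl

theorem cyclicVariationFun_le {f : ℝ → ℝ} {B : ℕ∞}
    (h : ∀ (m : ℕ) (x : Fin m → ℝ), StrictMono x →
      (∀ i, x i ∈ Set.Ico (0 : ℝ) (2 * Real.pi)) → (cyclicVariation (fun i => f (x i)) : ℕ∞) ≤ B) :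
    cyclicVariationFun f ≤ B :=
  iSup₂_le fun m _ => iSup₂_le fun x hx => iSup_le fun hmem => h m x hx hmem

theorem le_cyclicVariationFun (f : ℝ → ℝ) {k : ℕ} (hk : Even k) {y : Fin k → ℝ}
    (hy : StrictMono y) (hmem : ∀ i, y i ∈ Set.Ico (0 : ℝ) (2 * Real.pi)) (s : ℝ)
    (hs : ∀ i : Fin k, 0 < s * (-1) ^ (i : ℕ) * f (y i)) : (k : ℕ∞) ≤ cyclicVariationFun f := by
  rcases Nat.eq_zero_or_pos k with rfl | hpos
  · simp
  have h2 : 2 ≤ k := by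
    rw [Nat.even_iff] at hk
    omega
  refine le_trans ?_ (cyclicVariation_le_cyclicVariationFun f h2 hy hmem)
  exact_mod_cast le_cyclicVariation hk (fun i => f (y i)) id strictMono_id s hs

/-- Between consecutive sign changes around the circle there is a zero. -/
theorem cyclicVariationFun_le_zeroCount {f : ℝ → ℝ} (hf : Continuous f)
    (hper : Function.Periodic f (2 * Real.pi)) : cyclicVariationFun f ≤ zeroCount f := by
  refine cyclicVariationFun_le fun m x hx hmem => ?_
  have hev := even_cyclicVariation fun i => f (x i)
  obtain ⟨k, hk, e, s, he, hs⟩ : ∃ k, cyclicVariation (fun i => f (x i)) = k ∧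
      ∃ (e : Fin k → Fin m) (s : ℝ), StrictMono e ∧
        ∀ i : Fin k, 0 < s * (-1) ^ (i : ℕ) * f (x (e i)) :=
    ⟨_, rfl, exists_alternating fun i => f (x i)⟩
  rw [hk] at hev ⊢
  rcases Nat.eq_zero_or_pos k with h0 | hpos
  · rw [h0]; simp
  have hpi := Real.pi_pos
  set a := x (e ⟨0, hpos⟩) with ha
  let Y : ℕ → ℝ := fun i => if h : i < k then x (e ⟨i, h⟩) else a + 2 * Real.pi
  have hYlt : ∀ i j, i < j → j ≤ k → Y i < Y j := fun i j hij hj => by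
    simp only [Y]
    rw [dif_pos (hij.trans_le hj)]
    split_ifs with h
    · exact hx (he (by simpa using hij))
    · have h1 := (hmem (e ⟨i, hij.trans_le hj⟩)).2
      have h2 := (hmem (e ⟨0, hpos⟩)).1
      linarith
  have hYsign : ∀ i ≤ k, 0 < s * (-1) ^ i * f (Y i) := fun i hi => by
    simp only [Y]
    split_ifs with h
    · exact hs ⟨i, h⟩
    · have : i = k := by omega
      rw [this, hev.neg_one_pow, hper, ha]
      simpa using hs ⟨0, hpos⟩
  have hz : ∀ i : Fin k, ∃ z ∈ Set.Ioo (Y i) (Y (i + 1)), f z = 0 := fun i => by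
    have h1 := hYsign i i.2.le
    have h2 := hYsign (i + 1) i.2
    have hc : Continuous fun u => s * (-1) ^ (i : ℕ) * f u := by fun_prop
    obtain ⟨z, hz, hz0⟩ := intermediate_value_Ioo' (hYlt i (i + 1) (Nat.lt_succ_self _) i.2).le
      hc.continuousOn (show (0 : ℝ) ∈ Set.Ioo _ _ from
        ⟨by rw [pow_succ] at h2; linarith, h1⟩)
    refine ⟨z, hz, (mul_eq_zero.mp hz0).resolve_left ?_⟩
    exact left_ne_zero_of_mul h1.ne'
  choose z hz hz0 using hz
  have hzmono : StrictMono z := fun i j hij => by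
    refine (hz i).2.trans_le (le_trans ?_ (hz j).1.le)
    rcases (Nat.succ_le_of_lt (show (i : ℕ) < j from hij)).eq_or_lt with h | h
    · rw [← h]
    · exact (hYlt _ _ h j.2.le).le
  have hsub : Set.range z ⊆ Set.Ico a (a + 2 * Real.pi) ∩ {u | f u = 0} := by
    rintro _ ⟨i, rfl⟩
    have hY0 : Y 0 = a := dif_pos hpos
    have hYk : Y k = a + 2 * Real.pi := dif_neg (lt_irrefl k)
    refine ⟨⟨?_, ?_⟩, hz0 i⟩
    · refine le_trans ?_ (hz i).1.le
      rcases Nat.eq_zero_or_pos (i : ℕ) with h | h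
      · rw [h, hY0]
      · rw [← hY0]; exact (hYlt 0 i h i.2.le).le
    · refine (hz i).2.trans_le ?_
      rcases (Nat.succ_le_of_lt i.2).eq_or_lt with h | h
      · exact ((congrArg Y h).trans hYk).le
      · rw [← hYk]; exact (hYlt _ k h le_rfl).le
  rw [zeroCount_eq_encard (fun u => by rw [hper u]) a]
  exact le_trans (by simp) (hzmono.injective.encard_range.trans (Set.encard_le_encard hsub))

/-! ### Variation diminution of mixtures -/

theorem cyclicVariationFun_mixture_sub_eq_zero (n : ℕ) (c : Fin (2 * n + 1) → ℝ) (α s : ℝ)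
    (hs : s ≠ 0) (h : ∀ j, 0 ≤ s * (scaledCoeff n c j - α)) :
    cyclicVariationFun (fun u => mixture n c u - α) = 0 := by
  refine le_antisymm (cyclicVariationFun_le fun m x _ _ => ?_) zero_le
  rw [cyclicVariation_eq_zero _ s hs fun i => ?_]
  · simp
  · rw [mixture_sub, mul_left_comm, Finset.mul_sum]
    have := Real.pi_pos
    refine mul_nonneg (by positivity) (Finset.sum_nonneg fun j _ => ?_)
    rw [← mul_assoc]
    exact mul_nonneg (h j) (basisDensity_nonneg n j _)

theorem continuous_mixture (n : ℕ) (c : Fin (2 * n + 1) → ℝ) : Continuous (mixture n c) :=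
  (contDiff_mixture n c).continuous

theorem cyclicVariationFun_mixture_sub_le_zeroCount (n : ℕ) (c : Fin (2 * n + 1) → ℝ) (α : ℝ) :
    cyclicVariationFun (fun u => mixture n c u - α) ≤
      zeroCount (fun u => mixture n c u - α) :=
  cyclicVariationFun_le_zeroCount ((continuous_mixture n c).sub continuous_const)
    fun u => by simp only [mixture_periodic n c u]

/-- The sign changes of `C_n - α` are bounded by those of its coefficients, without any condition on
how many of these vanish. -/
theorem cyclicVariationFun_mixture_sub_le (n : ℕ) (c : Fin (2 * n + 1) → ℝ) (α : ℝ) :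
    cyclicVariationFun (fun u => mixture n c u - α) ≤
      cyclicVariation fun j => scaledCoeff n c j - α := by
  by_cases h : ∃ i j, i ≠ j ∧ scaledCoeff n c i ≠ α ∧ scaledCoeff n c j ≠ α
  · exact (cyclicVariationFun_mixture_sub_le_zeroCount n c α).trans
      (zeroCount_mixture_sub_le n c α (Or.inr h))
  -- With at most one nonzero coefficient the mixture does not change sign.
  have hsign : ∃ s : ℝ, s ≠ 0 ∧ ∀ j, 0 ≤ s * (scaledCoeff n c j - α) := by
    by_cases h0 : ∃ i, scaledCoeff n c i ≠ α
    · obtain ⟨i, hi⟩ := h0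
      refine ⟨scaledCoeff n c i - α, sub_ne_zero.mpr hi, fun j => ?_⟩
      by_cases hij : i = j
      · rw [hij]; exact mul_self_nonneg _
      · by_cases hj : scaledCoeff n c j = α
        · rw [hj]; simp
        · exact absurd ⟨i, j, hij, hi, hj⟩ h
    · push Not at h0
      exact ⟨1, one_ne_zero, fun j => by simp [h0 j]⟩
  obtain ⟨s, hs, hnn⟩ := hsign
  rw [cyclicVariationFun_mixture_sub_eq_zero n c α s hs hnn]
  exact zero_le

/-! ### Total variation -/

theorem adjacentChanges_ofFn {k : ℕ} (g : Fin (k + 1) → ℝ) :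
    adjacentChanges (List.ofFn g) =
      ∑ i : Fin k, if g i.castSucc * g i.succ < 0 then 1 else 0 := by
  induction k with
  | zero => simp [adjacentChanges]
  | succ k ih =>
    rw [List.ofFn_succ, List.ofFn_succ, adjacentChanges, Fin.sum_univ_succ]
    have := ih fun i => g i.succ
    rw [List.ofFn_succ] at this
    rw [this]
    rfl

theorem cyclicVariation_eq_sum_of_ne_zero {k : ℕ} (x : Fin (k + 1) → ℝ) (hx : ∀ i, x i ≠ 0) :
    cyclicVariation x = ∑ i, if x i * x (i + 1) < 0 then 1 else 0 := by
  have h1 : cycleFrom x 0 = List.ofFn (Fin.snoc x (x 0) : Fin (k + 2) → ℝ) := by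
    rw [List.ofFn_succ']
    simp [cycleFrom]
  have h2 : ∀ a ∈ cycleFrom x 0, decide (a ≠ 0) = true := fun a ha => by
    simp only [cycleFrom, List.mem_append, List.mem_rotate, List.mem_ofFn', Set.mem_range,
      List.mem_singleton] at ha
    rcases ha with ⟨i, rfl⟩ | rfl
    · simpa using hx i
    · simpa using hx 0
  rw [cyclicVariation_eq x (hx 0), variation, List.filter_eq_self.mpr h2, h1,
    adjacentChanges_ofFn]
  refine Finset.sum_congr rfl fun i _ => ?_
  rw [Fin.snoc_castSucc]
  congr 3
  refine Fin.lastCases ?_ (fun j => ?_) i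
  · rw [Fin.succ_last, Fin.snoc_last, Fin.last_add_one]
  · rw [Fin.succ_castSucc, Fin.snoc_castSucc, Fin.coeSucc_eq_succ]

open MeasureTheory in
/-- A discrete Banach indicatrix formula. -/
theorem lintegral_cyclicVariation_sub {k : ℕ} (x : Fin (k + 1) → ℝ) :
    ∫⁻ α : ℝ, (cyclicVariation (fun i => x i - α) : ENNReal) =
      ENNReal.ofReal (∑ i, |x (i + 1) - x i|) := by
  have hset : ∀ i, {α : ℝ | (x i - α) * (x (i + 1) - α) < 0} =
      Set.Ioo (min (x i) (x (i + 1))) (max (x i) (x (i + 1))) := fun i => by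
    ext α
    simp only [Set.mem_ofPred_eq, Set.mem_Ioo, min_lt_iff, lt_max_iff, mul_neg_iff, sub_pos,
      sub_neg]
    constructor
    · tauto
    · rintro ⟨h1 | h1, h2 | h2⟩
      · exact absurd h1 h2.not_gt
      · tauto
      · tauto
      · exact absurd h1 h2.not_gt
  have hae : (fun α : ℝ => (cyclicVariation (fun i => x i - α) : ENNReal)) =ᵐ[volume]
      fun α => ∑ i, {α : ℝ | (x i - α) * (x (i + 1) - α) < 0}.indicator 1 α := by
    have h0 : ∀ᵐ α : ℝ, α ∉ Set.range x :=
      measure_eq_zero_iff_ae_notMem.mp ((Set.finite_range x).measure_zero _)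
    filter_upwards [h0] with α hα
    rw [cyclicVariation_eq_sum_of_ne_zero _ fun i h => hα ⟨i, sub_eq_zero.mp h⟩]
    push_cast
    refine Finset.sum_congr rfl fun i _ => ?_
    simp [Set.indicator_apply]
  have hmeas : ∀ i, MeasurableSet {α : ℝ | (x i - α) * (x (i + 1) - α) < 0} := fun i => by
    rw [hset]; exact measurableSet_Ioo
  rw [lintegral_congr_ae hae, lintegral_finsetSum _ fun i _ => measurable_one.indicator (hmeas i),
    ENNReal.ofReal_sum_of_nonneg fun i _ => abs_nonneg _]
  refine Finset.sum_congr rfl fun i _ => ?_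
  rw [lintegral_indicator_one (hmeas i), hset, Real.volume_Ioo, max_sub_min_eq_abs]

theorem sum_abs_sub_le_of_cyclicVariation_sub_le {k l : ℕ} (x : Fin (k + 1) → ℝ)
    (y : Fin (l + 1) → ℝ)
    (h : ∀ α : ℝ, cyclicVariation (fun i => x i - α) ≤ cyclicVariation fun j => y j - α) :
    ∑ i, |x (i + 1) - x i| ≤ ∑ j, |y (j + 1) - y j| := by
  rw [← ENNReal.ofReal_le_ofReal_iff (Finset.sum_nonneg fun i _ => abs_nonneg _),
    ← lintegral_cyclicVariation_sub, ← lintegral_cyclicVariation_sub]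
  exact MeasureTheory.lintegral_mono fun α => Nat.cast_le.mpr (h α)

theorem integral_abs_deriv_le_of_forall_abs_sub_le {f : ℝ → ℝ} (hf : ContDiff ℝ 1 f) {p q ε : ℝ}
    (hpq : p < q) (h : ∀ s ∈ Set.Icc p q, ∀ t ∈ Set.Icc p q, |deriv f s - deriv f t| ≤ ε) :
    ∫ u in p..q, |deriv f u| ≤ |f q - f p| + ε * (q - p) := by
  obtain ⟨t, ht, hft⟩ := exists_deriv_eq_slope f hpq hf.continuous.continuousOn
    (hf.differentiable one_ne_zero).differentiableOn
  have hcont : Continuous fun u => |deriv f u| := (hf.continuous_deriv le_rfl).abs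
  have hle : ∫ u in p..q, |deriv f u| ≤ ∫ _ in p..q, (|deriv f t| + ε) := by
    refine intervalIntegral.integral_mono_on hpq.le (hcont.intervalIntegrable _ _)
      intervalIntegrable_const fun s hs => ?_
    have h1 := h s hs t (Set.Ioo_subset_Icc_self ht)
    have h2 := abs_sub_abs_le_abs_sub (deriv f s) (deriv f t)
    linarith
  refine hle.trans (le_of_eq ?_)
  have hqp : 0 < q - p := sub_pos.mpr hpq
  rw [intervalIntegral.integral_const, smul_eq_mul, hft, abs_div, abs_of_pos hqp]
  field_simp

/-- The total variation is bounded by a common bound for the polygonal variations on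
equidistant grids. -/
theorem totalVariation_le_of_forall_sum_le {f : ℝ → ℝ} (hf : ContDiff ℝ 1 f) {B : ℝ}
    (h : ∀ N : ℕ, 2 ≤ N → ∑ i ∈ Finset.range N,
      |f (2 * Real.pi * ((i + 1 : ℕ) : ℝ) / N) - f (2 * Real.pi * (i : ℝ) / N)| ≤ B) :
    totalVariation f ≤ B := by
  have hpi := Real.two_pi_pos
  refine le_of_forall_pos_le_add fun η hη => ?_
  have hε : 0 < η / (2 * Real.pi) := by positivity
  have huc := isCompact_Icc.uniformContinuousOn_of_continuous
    (hf.continuous_deriv le_rfl).continuousOn (s := Set.Icc 0 (2 * Real.pi))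
  obtain ⟨δ, hδ, hδf⟩ := Metric.uniformContinuousOn_iff.mp huc _ hε
  obtain ⟨M, hM⟩ := exists_nat_gt (2 * Real.pi / δ)
  set N := M + 2
  have hN : (0 : ℝ) < N := by positivity
  have hNδ : 2 * Real.pi / N < δ := by
    rw [div_lt_iff₀ hδ] at hM
    rw [div_lt_iff₀ hN]
    have : (N : ℝ) = M + 2 := by simp [N]
    rw [this]
    nlinarith
  have hcont : Continuous fun u => |deriv f u| := (hf.continuous_deriv le_rfl).abs
  have hsum := intervalIntegral.sum_integral_adjacent_intervals (f := fun u => |deriv f u|)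
    (μ := MeasureTheory.volume) (a := fun i : ℕ => 2 * Real.pi * (i : ℝ) / N) (n := N)
    fun i _ => hcont.intervalIntegrable _ _
  have h0 : 2 * Real.pi * ((0 : ℕ) : ℝ) / N = 0 := by simp
  have h1 : 2 * Real.pi * (N : ℝ) / N = 2 * Real.pi := by field_simp
  simp only [h0, h1] at hsum
  rw [totalVariation, ← hsum]
  have hstep : ∀ i ∈ Finset.range N, ∫ u in (2 * Real.pi * (i : ℝ) / N)..(2 * Real.pi *
      ((i + 1 : ℕ) : ℝ) / N), |deriv f u| ≤
      |f (2 * Real.pi * ((i + 1 : ℕ) : ℝ) / N) - f (2 * Real.pi * (i : ℝ) / N)| + η / N := by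
    intro i hi
    have hiN : ((i + 1 : ℕ) : ℝ) ≤ N := by exact_mod_cast Finset.mem_range.mp hi
    have hlen : 2 * Real.pi * ((i + 1 : ℕ) : ℝ) / N - 2 * Real.pi * (i : ℝ) / N =
        2 * Real.pi / N := by push_cast; ring
    have hpos : 0 < 2 * Real.pi / N := by positivity
    have hmem : ∀ s ∈ Set.Icc (2 * Real.pi * (i : ℝ) / N) (2 * Real.pi * ((i + 1 : ℕ) : ℝ) / N),
        s ∈ Set.Icc 0 (2 * Real.pi) := fun s hs => by
      refine ⟨le_trans (by positivity) hs.1, hs.2.trans ?_⟩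
      rw [div_le_iff₀ hN]
      exact mul_le_mul_of_nonneg_left hiN hpi.le
    have := integral_abs_deriv_le_of_forall_abs_sub_le hf (ε := η / (2 * Real.pi))
      (show 2 * Real.pi * (i : ℝ) / N < 2 * Real.pi * ((i + 1 : ℕ) : ℝ) / N by linarith)
      fun s hs t ht => by
        refine (hδf s (hmem s hs) t (hmem t ht) ?_).le
        rw [Real.dist_eq, abs_lt]
        constructor <;> linarith [hs.1, hs.2, ht.1, ht.2]
    refine this.trans (le_of_eq ?_)
    rw [hlen]
    field_simp
  refine (Finset.sum_le_sum hstep).trans ?_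
  rw [Finset.sum_add_distrib, Finset.sum_const, Finset.card_range, nsmul_eq_mul,
    mul_div_cancel₀ _ hN.ne']
  exact add_le_add_left (h N (by omega)) η

theorem sum_range_abs_sub_eq_cyclic {k : ℕ} (F : ℕ → ℝ) (hF : F (k + 1) = F 0) :
    ∑ i ∈ Finset.range (k + 1), |F (i + 1) - F i| =
      ∑ i : Fin (k + 1), |F ((i + 1 : Fin (k + 1)) : ℕ) - F i| := by
  rw [Finset.sum_range]
  refine Finset.sum_congr rfl fun i _ => ?_
  rw [Fin.val_add_one]
  split_ifs with h
  · rw [h, Fin.val_last, hF]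
  · rfl

theorem totalVariation_mixture_le (n : ℕ) (c : Fin (2 * n + 1) → ℝ) :
    totalVariation (mixture n c) ≤
      (2 * (n : ℝ) + 1) / (2 * Real.pi) * ∑ j, |c (j + 1) - c j| := by
  have hpi := Real.two_pi_pos
  have hK : 0 ≤ (2 * (n : ℝ) + 1) / (2 * Real.pi) := div_nonneg (by positivity) hpi.le
  have hscale : (2 * (n : ℝ) + 1) / (2 * Real.pi) * ∑ j, |c (j + 1) - c j| =
      ∑ j, |scaledCoeff n c (j + 1) - scaledCoeff n c j| := by
    rw [Finset.mul_sum]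
    refine Finset.sum_congr rfl fun j _ => ?_
    rw [scaledCoeff, scaledCoeff, ← mul_sub, abs_mul, abs_of_nonneg hK]
  rw [hscale]
  refine totalVariation_le_of_forall_sum_le ((contDiff_mixture n c).of_le (by simp))
    fun N hN => ?_
  obtain ⟨k, rfl⟩ : ∃ k, N = k + 1 := ⟨N - 1, by omega⟩
  have hk : (0 : ℝ) < ((k + 1 : ℕ) : ℝ) := by positivity
  rw [sum_range_abs_sub_eq_cyclic
    (fun i => mixture n c (2 * Real.pi * (i : ℝ) / ((k + 1 : ℕ) : ℝ)))]
  · refine sum_abs_sub_le_of_cyclicVariation_sub_le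
      (fun i : Fin (k + 1) => mixture n c (2 * Real.pi * (i : ℝ) / ((k + 1 : ℕ) : ℝ)))
      (scaledCoeff n c) fun α => ?_
    have h1 := cyclicVariation_le_cyclicVariationFun (fun u => mixture n c u - α) hN
      (x := fun i : Fin (k + 1) => 2 * Real.pi * (i : ℝ) / ((k + 1 : ℕ) : ℝ))
      (fun i j hij => by
        have : (i : ℝ) < (j : ℝ) := by exact_mod_cast hij
        simp only
        gcongr)
      (fun i => by
        have : (i : ℝ) < ((k + 1 : ℕ) : ℝ) := by exact_mod_cast i.2
        refine ⟨by positivity, ?_⟩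
        rw [div_lt_iff₀ hk]
        exact mul_lt_mul_of_pos_left this hpi)
    exact_mod_cast h1.trans (cyclicVariationFun_mixture_sub_le n c α)
  · have e : 2 * Real.pi * ((k + 1 : ℕ) : ℝ) / ((k + 1 : ℕ) : ℝ) = 0 + 2 * Real.pi := by
      field_simp
      ring
    rw [e, mixture_periodic n c]
    simp

theorem sum_abs_cyclicDiff_le {N : ℕ} [NeZero N] {c : Fin N → ℝ} (hc : ∀ j, 0 ≤ c j) :
    ∑ j, |c (j + 1) - c j| ≤ 2 * ∑ j, c j := by
  calc ∑ j, |c (j + 1) - c j| ≤ ∑ j, (c (j + 1) + c j) := Finset.sum_le_sum fun j _ => by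
        rw [abs_le]
        constructor <;> linarith [hc j, hc (j + 1)]
    _ = 2 * ∑ j, c j := by
        rw [Finset.sum_add_distrib, two_mul]
        exact congrArg (· + _) (Equiv.sum_comp (Equiv.addRight (1 : Fin N)) c)

/-! ### Periodic unimodality -/

theorem exists_peak {g : ℝ → ℝ} (hg : Differentiable ℝ g) {a b : ℝ} (hab : a < b)
    (ha : 0 < deriv g a) (hb : deriv g b < 0) : ∃ p ∈ Set.Ioo a b, g a < g p ∧ g b < g p := by
  have h1 := (hasDerivAt_iff_tendsto_slope_left_right.mp (hg a).hasDerivAt).2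
  have h2 := (hasDerivAt_iff_tendsto_slope_left_right.mp (hg b).hasDerivAt).1
  obtain ⟨q, hq, hqm⟩ := ((h1.eventually_const_lt ha).and (Ioo_mem_nhdsGT hab)).exists
  obtain ⟨r, hr, hrm⟩ := ((h2.eventually_lt_const hb).and (Ioo_mem_nhdsLT hab)).exists
  rw [slope_def_field] at hq hr
  have hq' : g a < g q := by
    have := (div_pos_iff_of_pos_right (sub_pos.mpr hqm.1)).mp hq
    linarith
  have hr' : g b < g r := by
    rcases div_neg_iff.mp hr with h | h
    · linarith
    · linarith [hrm.2]
  rcases le_total (g q) (g r) with h | h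
  · exact ⟨r, hrm, by linarith, hr'⟩
  · exact ⟨q, hqm, hq', by linarith⟩

theorem exists_valley {g : ℝ → ℝ} (hg : Differentiable ℝ g) {a b : ℝ} (hab : a < b)
    (ha : deriv g a < 0) (hb : 0 < deriv g b) : ∃ p ∈ Set.Ioo a b, g p < g a ∧ g p < g b := by
  obtain ⟨p, hp, h1, h2⟩ := exists_peak hg.neg hab (by rw [deriv.neg]; linarith)
    (by rw [deriv.neg]; linarith)
  exact ⟨p, hp, neg_lt_neg_iff.mp h1, neg_lt_neg_iff.mp h2⟩

theorem periodic_deriv {f : ℝ → ℝ} {T : ℝ} (hper : Function.Periodic f T) :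
    Function.Periodic (deriv f) T := fun u => by
  rw [← deriv_comp_add_const, show (fun v => f (v + T)) = f from funext hper]

/-- Four alternating slopes around the circle enclose two peaks and two valleys, and some level
separates the peaks from the valleys. -/
theorem exists_alternating_level {f : ℝ → ℝ} (hf : Differentiable ℝ f)
    (hper : Function.Periodic f (2 * Real.pi)) {x : Fin 4 → ℝ} (hx : StrictMono x)
    (hmem : ∀ i, x i ∈ Set.Ico (0 : ℝ) (2 * Real.pi)) (s : ℝ)
    (hs : ∀ i : Fin 4, 0 < s * (-1) ^ (i : ℕ) * deriv f (x i)) :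
    ∃ α : ℝ, 4 ≤ cyclicVariationFun fun v => f v - α := by
  have hpi := Real.two_pi_pos
  have hder : ∀ u, deriv (fun v => s * f v) u = s * deriv f u := fun u => by
    rw [deriv_const_mul _ (hf u)]
  have hg : Differentiable ℝ fun v => s * f v := hf.const_mul s
  have d0 := hs 0
  have d1 := hs 1
  have d2 := hs 2
  have d3 := hs 3
  norm_num [pow_succ] at d0 d1 d2 d3
  have d4 : deriv f (x 0 + 2 * Real.pi) = deriv f (x 0) := periodic_deriv hper (x 0)
  have h01 : x 0 < x 1 := hx (by decide)
  have h12 : x 1 < x 2 := hx (by decide)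
  have h23 : x 2 < x 3 := hx (by decide)
  have h34 : x 3 < x 0 + 2 * Real.pi := by linarith [(hmem 3).2, (hmem 0).1]
  obtain ⟨p0, m0, a0, b0⟩ := exists_peak hg h01 (by rw [hder]; linarith) (by rw [hder]; linarith)
  obtain ⟨p1, m1, a1, b1⟩ := exists_valley hg h12 (by rw [hder]; linarith) (by rw [hder]; linarith)
  obtain ⟨p2, m2, a2, b2⟩ := exists_peak hg h23 (by rw [hder]; linarith) (by rw [hder]; linarith)
  obtain ⟨p3, m3, a3, b3⟩ := exists_valley hg h34 (by rw [hder]; linarith)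
    (by rw [hder, d4]; linarith)
  simp only [hper (x 0)] at b3
  obtain ⟨β, hβ1, hβ2⟩ := exists_between
    (show max (s * f p1) (s * f p3) < min (s * f p0) (s * f p2) from
      max_lt (lt_min (by linarith) (by linarith)) (lt_min (by linarith) (by linarith)))
  obtain ⟨v1, v3⟩ := max_lt_iff.mp hβ1
  obtain ⟨v0, v2⟩ := lt_min_iff.mp hβ2
  have hs0 : s ≠ 0 := by rintro rfl; simp at d0
  obtain ⟨α, rfl⟩ : ∃ α, β = s * α := ⟨β / s, by field_simp⟩
  refine ⟨α, ?_⟩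
  have M0 := hmem 0
  have M3 := hmem 3
  have hfour : ((4 : ℕ) : ℕ∞) = 4 := rfl
  rw [← hfour]
  by_cases hp3 : p3 < 2 * Real.pi
  · refine le_cyclicVariationFun _ (by decide) (y := ![p0, p1, p2, p3]) ?_ ?_ s ?_
    · rw [Fin.strictMono_iff_lt_succ]
      intro i
      fin_cases i
      · exact m0.2.trans m1.1
      · exact m1.2.trans m2.1
      · exact m2.2.trans m3.1
    · intro i
      fin_cases i
      · exact ⟨by simp; linarith [M0.1, m0.1], by simp; linarith [M3.2, m0.2]⟩
      · exact ⟨by simp; linarith [M0.1, m1.1], by simp; linarith [M3.2, m1.2]⟩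
      · exact ⟨by simp; linarith [M0.1, m2.1], by simp; linarith [M3.2, m2.2]⟩
      · exact ⟨by simp; linarith [M0.1, m3.1], by simpa using hp3⟩
    · intro i
      fin_cases i <;> norm_num [pow_succ] <;> linarith
  · -- The last valley lies beyond `2π`: shifted back by one period it comes first.
    have hf3 : f (p3 - 2 * Real.pi) = f p3 := hper.sub_eq p3
    refine le_cyclicVariationFun _ (by decide) (y := ![p3 - 2 * Real.pi, p0, p1, p2]) ?_ ?_ (-s) ?_
    · rw [Fin.strictMono_iff_lt_succ]
      intro i
      fin_cases i
      · show p3 - 2 * Real.pi < p0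
        linarith [m3.2, m0.1]
      · exact m0.2.trans m1.1
      · exact m1.2.trans m2.1
    · intro i
      fin_cases i
      · exact ⟨by simp; linarith, by simp; linarith [m3.2, M0.2]⟩
      · exact ⟨by simp; linarith [M0.1, m0.1], by simp; linarith [M3.2, m0.2]⟩
      · exact ⟨by simp; linarith [M0.1, m1.1], by simp; linarith [M3.2, m1.2]⟩
      · exact ⟨by simp; linarith [M0.1, m2.1], by simp; linarith [M3.2, m2.2]⟩
    · intro i
      fin_cases i <;> norm_num [pow_succ, hf3] <;> linarith

theorem exists_four_alternating {m : ℕ} (x : Fin m → ℝ) (h : ¬ cyclicVariation x ≤ 2) :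
    ∃ (e : Fin 4 → Fin m) (s : ℝ), StrictMono e ∧
      ∀ i : Fin 4, 0 < s * (-1) ^ (i : ℕ) * x (e i) := by
  have h4 : 4 ≤ cyclicVariation x := by
    have := Nat.even_iff.mp (even_cyclicVariation x)
    omega
  obtain ⟨e, s, he, hs⟩ := exists_alternating x
  exact ⟨fun i => e (Fin.castLE h4 i), s, fun i j hij => he (Fin.strictMono_castLE h4 hij),
    fun i => hs (Fin.castLE h4 i)⟩

theorem exists_neg_diff {A : ℕ → ℝ} {p q : ℕ} (hpq : p ≤ q) (h : A q < A p) :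
    ∃ j, p ≤ j ∧ j < q ∧ A (j + 1) - A j < 0 := by
  by_contra! hcon
  have : ∀ r, p ≤ r → r ≤ q → A p ≤ A r := fun r hr => by
    induction r, hr using Nat.le_induction with
    | base => exact fun _ => le_rfl
    | succ r hr ih => exact fun hrq => by linarith [ih (by omega), hcon r hr (by omega)]
  linarith [this q hpq le_rfl]

/-- The differences of a sequence alternate at least where the sequence alternates about a level. -/
theorem cyclicVariation_sub_le_two {k : ℕ} (c : Fin (k + 1) → ℝ) (α : ℝ)
    (h : cyclicVariation (cyclicDiff c) ≤ 2) : cyclicVariation (fun j => c j - α) ≤ 2 := by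
  by_contra hcon
  obtain ⟨e, s, he, hs⟩ := exists_four_alternating _ hcon
  refine absurd h (not_le.mpr (lt_of_lt_of_le (by norm_num : 2 < 4) ?_))
  let A : ℕ → ℝ := fun i => s * c (Fin.ofNat (k + 1) i)
  have hA : ∀ i : Fin (k + 1), A i = s * c i := fun i => by simp [A]
  have hAper : ∀ i, A (i + (k + 1)) = A i := fun i => by simp [A, Fin.ofNat]
  have hD : ∀ i (hi : i < k + 1), A (i + 1) - A i = s * cyclicDiff c ⟨i, hi⟩ := fun i hi => by
    have h1 : Fin.ofNat (k + 1) i = ⟨i, hi⟩ := Fin.ext (Nat.mod_eq_of_lt hi)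
    have h2 : Fin.ofNat (k + 1) (i + 1) = ⟨i, hi⟩ + 1 := by
      rw [← h1]
      apply Fin.ext
      simp [Fin.val_add]
    simp only [A, cyclicDiff]
    rw [h2, h1, mul_sub]
  have v0 := hs 0
  have v1 := hs 1
  have v2 := hs 2
  have v3 := hs 3
  norm_num [pow_succ] at v0 v1 v2 v3
  have l01 : (e 0 : ℕ) < e 1 := he (by decide)
  have l12 : (e 1 : ℕ) < e 2 := he (by decide)
  have l23 : (e 2 : ℕ) < e 3 := he (by decide)
  have l3 := (e 3).2
  obtain ⟨j0, a0, b0, s0⟩ := exists_neg_diff l01.le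
    (show A (e 1) < A (e 0) by rw [hA, hA]; linarith)
  obtain ⟨j1, a1, b1, s1⟩ := exists_neg_diff (A := -A) l12.le
    (show -A (e 2) < -A (e 1) by rw [hA, hA]; linarith)
  obtain ⟨j2, a2, b2, s2⟩ := exists_neg_diff l23.le
    (show A (e 3) < A (e 2) by rw [hA, hA]; linarith)
  obtain ⟨j3, a3, b3, s3⟩ := exists_neg_diff (A := -A)
    (show (e 3 : ℕ) ≤ (e 0 : ℕ) + (k + 1) by omega)
    (show -A (e 0 + (k + 1)) < -A (e 3) by rw [hAper, hA, hA]; linarith)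
  simp only [Pi.neg_apply] at s1 s3
  have t0 := hD j0 (by omega)
  have t1 := hD j1 (by omega)
  have t2 := hD j2 (by omega)
  by_cases hj : j3 < k + 1
  · have t3 := hD j3 hj
    refine le_cyclicVariation (by decide) _
      ![⟨j0, by omega⟩, ⟨j1, by omega⟩, ⟨j2, by omega⟩, ⟨j3, hj⟩] ?_ (-s) ?_
    · rw [Fin.strictMono_iff_lt_succ]
      intro i
      fin_cases i
      · exact (show j0 < j1 by omega)
      · exact (show j1 < j2 by omega)
      · exact (show j2 < j3 by omega)
    · intro i
      fin_cases i <;> norm_num [pow_succ] <;> linarith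
  · -- The last difference is taken past the end of the sequence: it comes first.
    have t3 := hD (j3 - (k + 1)) (by omega)
    have e1 : A (j3 - (k + 1) + 1) = A (j3 + 1) := by
      rw [← hAper (j3 - (k + 1) + 1)]
      congr 1
      omega
    have e2 : A (j3 - (k + 1)) = A j3 := by
      rw [← hAper (j3 - (k + 1))]
      congr 1
      omega
    rw [e1, e2] at t3
    refine le_cyclicVariation (by decide) _
      ![⟨j3 - (k + 1), by omega⟩, ⟨j0, by omega⟩, ⟨j1, by omega⟩, ⟨j2, by omega⟩] ?_ s ?_
    · rw [Fin.strictMono_iff_lt_succ]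
      intro i
      fin_cases i
      · exact (show j3 - (k + 1) < j0 by omega)
      · exact (show j0 < j1 by omega)
      · exact (show j1 < j2 by omega)
    · intro i
      fin_cases i <;> norm_num [pow_succ] <;> linarith

theorem cyclicVariation_const_mul_le {m : ℕ} (x : Fin m → ℝ) (r : ℝ) :
    cyclicVariation (fun i => r * x i) ≤ cyclicVariation x := by
  obtain ⟨e, s, he, hs⟩ := exists_alternating fun i => r * x i
  exact le_cyclicVariation (even_cyclicVariation _) x e he (s * r) fun i => by
    linarith [hs i]

theorem zeroCount_const_zero : zeroCount (fun _ => 0) = ⊤ := by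
  have : {x : ℝ | x ∈ Set.Ico (0 : ℝ) (2 * Real.pi) ∧ (0 : ℝ) = 0} =
      Set.Ico 0 (2 * Real.pi) := by ext; simp
  rw [zeroCount, this, Set.encard_eq_top_iff]
  exact Set.Ico_infinite Real.two_pi_pos

/-- Only equal coefficients produce a constant mixture `α`: if two of them differ from `α`, the
value `α` is taken finitely often, and if just one does,
`C_n - α` is a nonzero multiple of one density. -/
theorem scaledCoeff_eq_of_mixture_eq_const (n : ℕ) (c : Fin (2 * n + 1) → ℝ) (α : ℝ)
    (h : ∀ u, mixture n c u = α) (j : Fin (2 * n + 1)) : scaledCoeff n c j = α := by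
  by_contra hj
  by_cases h2 : ∃ i, j ≠ i ∧ scaledCoeff n c i ≠ α
  · obtain ⟨i, hij, hi⟩ := h2
    have := zeroCount_mixture_sub_le n c α (Or.inr ⟨j, i, hij, hj, hi⟩)
    simp only [h, sub_self, zeroCount_const_zero, top_le_iff] at this
    exact ENat.natCast_ne_top _ this
  · push Not at h2
    have h3 := mixture_sub n c α (2 * Real.pi * (j : ℝ) / (2 * (n : ℝ) + 1))
    rw [h, sub_self, Finset.sum_eq_single j (fun i _ hij => by rw [h2 i hij.symm]; simp)
      (by simp)] at h3
    have hpos := basisDensity_coeff_pos n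
    have hpi := Real.pi_pos
    have hb : basisDensity n j (2 * Real.pi * (j : ℝ) / (2 * (n : ℝ) + 1)) ≠ 0 := by
      rw [basisDensity, sub_self, Real.cos_zero]
      exact mul_ne_zero hpos.ne' (pow_ne_zero _ (by norm_num))
    have hK : 2 * Real.pi / (2 * (n : ℝ) + 1) ≠ 0 := by positivity
    exact mul_ne_zero hK (mul_ne_zero (sub_ne_zero.mpr hj) hb) h3.symm

theorem eq_of_periodic_of_monotone {f : ℝ → ℝ} {T : ℝ} (hT : 0 < T) (hper : Function.Periodic f T)
    (hmono : Monotone f) (u : ℝ) : f u = f 0 := by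
  obtain ⟨N, hN⟩ := exists_nat_gt (|u| / T)
  rw [div_lt_iff₀ hT] at hN
  refine le_antisymm ?_ ?_
  · rw [← hper.nat_mul_eq N]
    exact hmono (by linarith [le_abs_self u])
  · have h : f u = f (u + N * T) := (hper.nat_mul N u).symm
    rw [h]
    exact hmono (by linarith [neg_abs_le u])

theorem exists_deriv_pos {f : ℝ → ℝ} (hf : Differentiable ℝ f)
    (hper : Function.Periodic f (2 * Real.pi)) (hne : ∃ u, f u ≠ f 0) :
    ∃ x ∈ Set.Ico (0 : ℝ) (2 * Real.pi), 0 < deriv f x := by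
  by_contra! hcon
  obtain ⟨u, hu⟩ := hne
  have hall : ∀ v, deriv f v ≤ 0 := fun v => by
    obtain ⟨w, hw, hvw⟩ := (periodic_deriv hper).exists_mem_Ico₀ Real.two_pi_pos v
    rw [hvw]
    exact hcon w hw
  have hanti := antitone_of_deriv_nonpos hf hall
  have := eq_of_periodic_of_monotone Real.two_pi_pos (f := fun v => -f v)
    (fun v => by simp only [hper v]) (fun a b hab => neg_le_neg (hanti hab)) u
  exact hu (neg_injective this)

theorem two_le_cyclicVariationFun_deriv {f : ℝ → ℝ} (hf : Differentiable ℝ f)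
    (hper : Function.Periodic f (2 * Real.pi)) (hne : ∃ u, f u ≠ f 0) :
    2 ≤ cyclicVariationFun (deriv f) := by
  obtain ⟨x, hx, hfx⟩ := exists_deriv_pos hf hper hne
  obtain ⟨y, hy, hfy⟩ := exists_deriv_pos hf.neg
    (fun v => by simp only [Pi.neg_apply, hper v]) (hne.imp fun u hu => by simpa using hu)
  rw [deriv.neg] at hfy
  have htwo : ((2 : ℕ) : ℕ∞) = 2 := rfl
  rw [← htwo]
  rcases lt_trichotomy x y with h | h | h
  · refine le_cyclicVariationFun _ (by decide) (y := ![x, y]) ?_ ?_ 1 ?_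
    · rw [Fin.strictMono_iff_lt_succ]
      intro i
      fin_cases i
      exact h
    · intro i
      fin_cases i
      exacts [hx, hy]
    · intro i
      fin_cases i <;> simp <;> linarith
  · rw [h] at hfx
    linarith
  · refine le_cyclicVariationFun _ (by decide) (y := ![y, x]) ?_ ?_ (-1) ?_
    · rw [Fin.strictMono_iff_lt_succ]
      intro i
      fin_cases i
      exact h
    · intro i
      fin_cases i
      exacts [hy, hx]
    · intro i
      fin_cases i <;> simp <;> linarith

theorem periodicallyUnimodal_mixture (n : ℕ) (c : Fin (2 * n + 1) → ℝ)
    (hc : PeriodicallyUnimodalSeq c) : PeriodicallyUnimodal (mixture n c) := by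
  have hdiff : Differentiable ℝ (mixture n c) := (contDiff_mixture n c).differentiable (by simp)
  have hper := mixture_periodic n c
  refine ⟨hper, hdiff, le_antisymm (cyclicVariationFun_le fun m x hx hmem => ?_) ?_⟩
  · have h2 : cyclicVariation (fun i => deriv (mixture n c) (x i)) ≤ 2 := by
      by_contra hcon
      obtain ⟨e, s, he, hs⟩ := exists_four_alternating _ hcon
      obtain ⟨α, h4⟩ := exists_alternating_level hdiff hper (x := fun i => x (e i))
        (hx.comp he) (fun i => hmem _) s hs
      have hseq : cyclicVariation (fun j => scaledCoeff n c j - α) ≤ 2 := by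
        refine cyclicVariation_sub_le_two _ _ ?_
        have e1 : cyclicDiff (scaledCoeff n c) =
            fun i => (2 * (n : ℝ) + 1) / (2 * Real.pi) * cyclicDiff c i := by
          ext i
          simp only [cyclicDiff, scaledCoeff, mul_sub]
        rw [e1]
        exact (cyclicVariation_const_mul_le _ _).trans (show cyclicVariation _ = 2 from hc).le
      have h5 := h4.trans (cyclicVariationFun_mixture_sub_le n c α)
      have h6 : 4 ≤ cyclicVariation fun j => scaledCoeff n c j - α := by exact_mod_cast h5
      omega
    exact_mod_cast h2
  · refine two_le_cyclicVariationFun_deriv hdiff hper ?_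
    by_contra! hcon
    have hconst := scaledCoeff_eq_of_mixture_eq_const n c _ hcon
    have hz : cyclicDiff c = fun _ => 0 := by
      ext i
      have h1 : scaledCoeff n c (i + 1) = scaledCoeff n c i := by rw [hconst, hconst]
      have hpi := Real.pi_pos
      have hK : (2 * (n : ℝ) + 1) / (2 * Real.pi) ≠ 0 := by positivity
      rw [cyclicDiff, sub_eq_zero]
      exact mul_left_cancel₀ hK h1
    have h0 := cyclicVariation_eq_zero (cyclicDiff c) 1 one_ne_zero fun i => by rw [hz]; simp
    have h2 : cyclicVariation (cyclicDiff c) = 2 := hc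
    omega

end VPMixture

theorem theorem2p3 (n : ℕ) (c : Fin (2 * n + 1) → ℝ)
    (hc : c ∈ stdSimplex ℝ (Fin (2 * n + 1))) :
    (∀ α : ℝ, 0 ≤ α →
      VPMixture.cyclicVariationFun (fun u => VPMixture.mixture n c u - α) ≤
          VPMixture.zeroCount (fun u => VPMixture.mixture n c u - α) ∧
      VPMixture.cyclicVariationFun (fun u => VPMixture.mixture n c u - α) ≤
          (VPMixture.cyclicVariation (fun j => VPMixture.scaledCoeff n c j - α) : ℕ∞) ∧
      ((n = 0 ∧ VPMixture.scaledCoeff n c 0 ≠ α) ∨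
          (∃ i j, i ≠ j ∧ VPMixture.scaledCoeff n c i ≠ α ∧ VPMixture.scaledCoeff n c j ≠ α) →
        VPMixture.zeroCount (fun u => VPMixture.mixture n c u - α) ≤
          (VPMixture.cyclicVariation (fun j => VPMixture.scaledCoeff n c j - α) : ℕ∞))) ∧
    (VPMixture.totalVariation (VPMixture.mixture n c) ≤
        (2 * (n : ℝ) + 1) / (2 * Real.pi) * ∑ j, |c (j + 1) - c j| ∧
      (2 * (n : ℝ) + 1) / (2 * Real.pi) * ∑ j, |c (j + 1) - c j| ≤
        (2 * (n : ℝ) + 1) / Real.pi) ∧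
    (VPMixture.PeriodicallyUnimodalSeq c →
      VPMixture.PeriodicallyUnimodal (VPMixture.mixture n c)) := by
  refine ⟨fun α _ => ⟨VPMixture.cyclicVariationFun_mixture_sub_le_zeroCount n c α,
    VPMixture.cyclicVariationFun_mixture_sub_le n c α,
    VPMixture.zeroCount_mixture_sub_le n c α⟩,
    ⟨VPMixture.totalVariation_mixture_le n c, ?_⟩, VPMixture.periodicallyUnimodal_mixture n c⟩
  have hpi := Real.pi_pos
  have hsum := VPMixture.sum_abs_cyclicDiff_le hc.1
  rw [hc.2, mul_one] at hsum
  calc (2 * (n : ℝ) + 1) / (2 * Real.pi) * ∑ j, |c (j + 1) - c j|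
      ≤ (2 * (n : ℝ) + 1) / (2 * Real.pi) * 2 := mul_le_mul_of_nonneg_left hsum (by positivity)
    _ = (2 * (n : ℝ) + 1) / Real.pi := by field_simp
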